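/- Let $n,\ell\ge 1$ be integers, let $K$ be a field whose characteristic does not divide $\ell$, and let $\zeta\in K$ be a primitive $\ell$-th root of unity. Put $\mathbb K=K[\hbar]$, a polynomial ring in one variable. Let $\Gamma$ be the group of $n\times n$ monomial matrices whose nonzero entries are $\ell$-th roots of unity in $K$ (so $\Gamma\cong\mu_\ell(K)\wr S_n$), with $S_n\subset\Gamma$ the permutation matrices, and let $t_j=\operatorname{diag}(1,\dots,\zeta,\dots,1)\in\Gamma$ with $\zeta$ in position $j$, $1\le j\le n$. Fix parameters $k,h_0,\dots,h_\ell\in\mathbb K$ and put $$p(v)=\sum_{s=1}^{\ell-1}\sum_{r=0}^{\ell}\zeta^{-rs}h_r v^s .$$ Let $\tilde A$ be the free $\mathbb K$-algebra generated by the group algebra $\mathbb K\Gamma$ and symbols $\sigma,\tau,u_1,\dots,u_n$. Define $u_i,t_i\in\tilde A$ for all $i\in\mathbb Z$ by $u_i=u_{i-n}-\hbar$ and $t_i=\zeta t_{i-n}$. Let $A$ be the quotient of $\tilde A$ by the relations - $u_i\,(j,j{+}1)=(j,j{+}1)\,u_{(j,j+1)\cdot i}-k(\delta_{i,j}-\delta_{i,j+1})\sum_{q=0}^{\ell-1}t_j^q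 t_{j+1}^{-q}$ for $1\le i\le n$, $1\le j\le n-1$; - $\sigma\,(j,j{-}1)=(j{+}1,j)\,\sigma$ and $\tau\,(j,j{+}1)=(j{-}1,j)\,\tau$ for $2\le j\le n-1$; - $\sigma\tau=u_1+p(t_1)$ and $\tau\sigma=u_n+\hbar+p(\zeta^{-1}t_n)$; - $u_iu_j=u_ju_i$ for $i,j\in\mathbb Z$; - $u_i\sigma=\sigma u_{i-1}$, $u_i\tau=\tau u_{i+1}$, $t_i\sigma=\sigma t_{i-1}$, $t_i\tau=\tau t_{i+1}$ for $i\in\mathbb Z$; - if $n\ge 2$, $\ \tau\,(1,2)\,\sigma=\sigma\,(n{-}1,n)\,\tau-k\sum_{q=0}^{\ell-1}\zeta^q t_1^q t_n^{-q}$. **Lemma.** The images of $u_1,\dots,u_n$ in $A$ commute pairwise, and the $\mathbb K$-subalgebra of $A$ that they generate is isomorphic to the polynomial ring $\mathbb K[U_1,\dots,U_n]$ in $n$ variables, by a $\mathbb K$-algebra isomorphism sending $U_i$ to $u_i$ for every $i$. -/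

import Mathlib

namespace DunklOpdam

/-- The group `Γ` of `n × n` monomial matrices whose nonzero entries are `ℓ`-th roots of unity of
`K`, as the wreath product `μ_ℓ(K)^n ⋊ S_n`: the pair `(d, w)` stands for the matrix `diag(d) P_w`
(see `monomialMatrix`), and `S_n` acts on `μ_ℓ(K)^n` by `(w • d) i = d (w⁻¹ i)`. -/
abbrev MonomialGroup (n ℓ : ℕ) (K : Type*) [Field K] : Type _ :=
  (Fin n → rootsOfUnity ℓ K) ⋊[mulAutArrow] Equiv.Perm (Fin n)

/-- The realization of `Γ` by monomial matrices: column `j` of the matrix of `(d, w)` has the entry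
`d (w j)` in row `w j` and zeros elsewhere. -/
def monomialMatrix (n ℓ : ℕ) (K : Type*) [Field K] :
    MonomialGroup n ℓ K →* Matrix (Fin n) (Fin n) K where
  toFun g := Matrix.of fun i j => if i = g.right j then ((g.left i : Kˣ) : K) else 0
  map_one' := by
    ext i j
    rw [Matrix.one_apply]
    by_cases hij : i = j <;> simp [hij]
  map_mul' g h := by
    ext i j
    rw [Matrix.mul_apply, Finset.sum_eq_single (h.right j)]
    · by_cases hi : i = g.right (h.right j)
      · subst hi
        have hs : (mulAutArrow g.right h.left) (g.right (h.right j)) = h.left (h.right j) := by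
          change h.left (g.right⁻¹ (g.right (h.right j))) = _
          simp
        simp [SemidirectProduct.mul_left, SemidirectProduct.mul_right, -mulAutArrow_apply_apply, hs]
      · simp [hi]
    · intro b _ hb
      simp [hb]
    · simp

/-- The realization by matrices is faithful. -/
theorem monomialMatrix_injective (n ℓ : ℕ) (K : Type*) [Field K] :
    Function.Injective (monomialMatrix n ℓ K) := by
  intro g h hgh
  have key : ∀ i j, (if i = g.right j then ((g.left i : Kˣ) : K) else 0) =
      if i = h.right j then ((h.left i : Kˣ) : K) else 0 := fun i j => congrFun (congrFun hgh i) j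
  have hr : g.right = h.right := by
    ext j
    by_contra hne
    have h1 := key (g.right j) j
    rw [if_pos rfl, if_neg (fun hh => hne (congrArg Fin.val hh))] at h1
    exact Units.ne_zero _ h1
  refine SemidirectProduct.ext ?_ hr
  funext i
  have h1 := key i (g.right⁻¹ i)
  rw [← hr] at h1
  have hi : g.right (g.right⁻¹ i) = i := by simp
  rw [hi, if_pos rfl, if_pos rfl] at h1
  exact Subtype.ext (Units.ext h1)

/-- The element `t_j = diag(1, …, ζ, …, 1)` of `Γ`. -/
def tGrp {n ℓ : ℕ} {K : Type*} [Field K] (ζ : rootsOfUnity ℓ K) (j : Fin n) :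
    MonomialGroup n ℓ K :=
  SemidirectProduct.inl (Pi.mulSingle j ζ)

/-- The residue of the integer `i` among `1, …, n`, as an element of `Fin n`
(so `1, …, n` go to the elements `0, …, n - 1` of `Fin n`). -/
def pos (n : ℕ) [NeZero n] (i : ℤ) : Fin n :=
  ⟨((i - 1) % (n : ℤ)).toNat, by
    have hn : (0 : ℤ) < n := by exact_mod_cast Nat.pos_of_ne_zero (NeZero.ne n)
    have h0 := Int.emod_nonneg (i - 1) hn.ne'
    have h1 := Int.emod_lt_of_pos (i - 1) hn
    omega⟩

/-- The number `q` such that `i - q n` lies in `{1, …, n}`. -/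
def turns (n : ℕ) (i : ℤ) : ℤ := (i - 1) / (n : ℤ)

/-- The transposition `(i, i + 1)` in `Γ`, for an integer `1 ≤ i ≤ n - 1`. -/
def sGrp (n ℓ : ℕ) (K : Type*) [Field K] [NeZero n] (i : ℤ) : MonomialGroup n ℓ K :=
  SemidirectProduct.inr (Equiv.swap (pos n i) (pos n (i + 1)))

/-- The generators: the elements of `Γ` and the symbols `σ`, `τ`, `u_1, …, u_n`. -/
inductive Gen (n ℓ : ℕ) (K : Type*) [Field K] : Type _
  | grp (g : MonomialGroup n ℓ K) : Gen n ℓ K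
  | sigma : Gen n ℓ K
  | tau : Gen n ℓ K
  | u (i : Fin n) : Gen n ℓ K

/-- The free algebra over `K[ħ]` on the generators. The relations of the group algebra `K[ħ]Γ` are
imposed in `Rel`, together with the other ones. -/
abbrev Free (n ℓ : ℕ) (K : Type*) [Field K] : Type _ :=
  FreeAlgebra (Polynomial K) (Gen n ℓ K)

/-- The variable `ħ` of `K[ħ]`. -/
noncomputable abbrev hbar (K : Type*) [Field K] : Polynomial K := Polynomial.X

/-- The constant `ζ ^ m` of `K[ħ]`, for an integer `m`. -/
noncomputable def zetaPow {ℓ : ℕ} {K : Type*} [Field K] (ζ : rootsOfUnity ℓ K) (m : ℤ) :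
    Polynomial K :=
  Polynomial.C ((((ζ : Kˣ) ^ m : Kˣ)) : K)

/-- The polynomial `p(v) = ∑_{s=1}^{ℓ-1} ∑_{r=0}^{ℓ} ζ^{-rs} h_r v^s` over `K[ħ]`. -/
noncomputable def pPoly {ℓ : ℕ} {K : Type*} [Field K] (ζ : rootsOfUnity ℓ K)
    (h : Fin (ℓ + 1) → Polynomial K) : Polynomial (Polynomial K) :=
  ∑ s ∈ Finset.Icc 1 (ℓ - 1), ∑ r : Fin (ℓ + 1),
    Polynomial.monomial s (zetaPow ζ (-((r : ℤ) * (s : ℤ))) * h r)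

section Words

variable {n ℓ : ℕ} {K : Type*} [Field K]

/-- An element of `Γ` as an element of the free algebra. -/
noncomputable def γ (g : MonomialGroup n ℓ K) : Free n ℓ K := FreeAlgebra.ι _ (Gen.grp g)

/-- The generator `σ`. -/
noncomputable def sig : Free n ℓ K := FreeAlgebra.ι _ Gen.sigma

/-- The generator `τ`. -/
noncomputable def tau : Free n ℓ K := FreeAlgebra.ι _ Gen.tau

/-- The generator `u_i`, `1 ≤ i ≤ n`. -/
noncomputable def uGen (i : Fin n) : Free n ℓ K := FreeAlgebra.ι _ (Gen.u i)

/-- The transposition `(i, i + 1)`, `1 ≤ i ≤ n - 1`, in the free algebra. -/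
noncomputable def sw [NeZero n] (i : ℤ) : Free n ℓ K := γ (sGrp n ℓ K i)

/-- The elements `u_i` for all integers `i`, with `u_i = u_{i-n} - ħ`. -/
noncomputable def uInt [NeZero n] (i : ℤ) : Free n ℓ K :=
  uGen (pos n i) - algebraMap (Polynomial K) (Free n ℓ K) ((turns n i : Polynomial K) * hbar K)

/-- The elements `t_i` for all integers `i`, with `t_i = ζ t_{i-n}`. -/
noncomputable def tInt [NeZero n] (ζ : rootsOfUnity ℓ K) (i : ℤ) : Free n ℓ K :=
  zetaPow ζ (turns n i) • γ (tGrp ζ (pos n i))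

/-- The coefficient `α_j^∨(ε_i)`, where `α_j^∨ = ε_j^∨ - ε_{j+1}^∨`. -/
def coroot [NeZero n] (j : ℤ) (i : Fin n) : ℤ :=
  (if i = pos n j then 1 else 0) - (if i = pos n (j + 1) then 1 else 0)

end Words

/-- The defining relations of `A`. In all of them the indices are those of `1, …, n` or, for
`uInt` and `tInt`, arbitrary integers. -/
inductive Rel {n ℓ : ℕ} {K : Type*} [Field K] [NeZero n] (ζ : rootsOfUnity ℓ K)
    (k : Polynomial K) (h : Fin (ℓ + 1) → Polynomial K) : Free n ℓ K → Free n ℓ K → Prop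
  | grp_one : Rel ζ k h (γ 1) 1
  | grp_mul (a b : MonomialGroup n ℓ K) : Rel ζ k h (γ (a * b)) (γ a * γ b)
  /-- `u_i (j,j+1) = (j,j+1) u_{(j,j+1)·i} - k α_j^∨(ε_i) ∑_{q=0}^{ℓ-1} t_j^q t_{j+1}^{-q}` -/
  | hecke (i : Fin n) (j : ℤ) (hj : 1 ≤ j) (hj' : j ≤ n - 1) :
      Rel ζ k h (uGen i * sw j)
        (sw j * uGen (Equiv.swap (pos n j) (pos n (j + 1)) i) -
          (k * (coroot j i : Polynomial K)) • ∑ q ∈ Finset.range ℓ,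
            γ (tGrp ζ (pos n j) ^ q * (tGrp ζ (pos n (j + 1)) ^ q)⁻¹))
  | sig_swap (j : ℤ) (hj : 2 ≤ j) (hj' : j ≤ n - 1) : Rel ζ k h (sig * sw (j - 1)) (sw j * sig)
  | tau_swap (j : ℤ) (hj : 2 ≤ j) (hj' : j ≤ n - 1) : Rel ζ k h (tau * sw j) (sw (j - 1) * tau)
  /-- `σ τ = u_1 + p(t_1)` -/
  | sig_tau : Rel ζ k h (sig * tau) (uInt 1 + Polynomial.aeval (tInt ζ 1) (pPoly ζ h))
  /-- `τ σ = u_n + ħ + p(ζ⁻¹ t_n)` -/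
  | tau_sig : Rel ζ k h (tau * sig)
      (uInt n + algebraMap (Polynomial K) (Free n ℓ K) (hbar K) +
        Polynomial.aeval (zetaPow ζ (-1) • tInt ζ n) (pPoly ζ h))
  | u_comm (i j : ℤ) : Rel ζ k h (uInt i * uInt j) (uInt j * uInt i)
  | u_sig (i : ℤ) : Rel ζ k h (uInt i * sig) (sig * uInt (i - 1))
  | u_tau (i : ℤ) : Rel ζ k h (uInt i * tau) (tau * uInt (i + 1))
  | t_sig (i : ℤ) : Rel ζ k h (tInt ζ i * sig) (sig * tInt ζ (i - 1))
  | t_tau (i : ℤ) : Rel ζ k h (tInt ζ i * tau) (tau * tInt ζ (i + 1))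
  /-- `τ (1,2) σ = σ (n-1,n) τ - k ∑_{q=0}^{ℓ-1} ζ^q t_1^q t_n^{-q}`, for `n ≥ 2` -/
  | last (hn : 2 ≤ n) : Rel ζ k h (tau * sw 1 * sig)
      (sig * sw ((n : ℤ) - 1) * tau - k • ∑ q ∈ Finset.range ℓ,
        zetaPow ζ q • γ (tGrp ζ (pos n 1) ^ q * (tGrp ζ (pos n n) ^ q)⁻¹))

/-- The `K[ħ]`-algebra `A`: the quotient of the free algebra by the two-sided ideal generated by the
relations. -/
abbrev Alg {n ℓ : ℕ} {K : Type*} [Field K] [NeZero n] (ζ : rootsOfUnity ℓ K)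
    (k : Polynomial K) (h : Fin (ℓ + 1) → Polynomial K) : Type _ :=
  RingQuot (Rel (n := n) ζ k h)

/-- The Dunkl–Opdam element `u_i` of `A`, `1 ≤ i ≤ n`. -/
noncomputable def u {n ℓ : ℕ} {K : Type*} [Field K] [NeZero n] (ζ : rootsOfUnity ℓ K)
    (k : Polynomial K) (h : Fin (ℓ + 1) → Polynomial K) (i : Fin n) : Alg (n := n) ζ k h :=
  RingQuot.mkAlgHom (Polynomial K) (Rel (n := n) ζ k h) (uGen i)

end DunklOpdam

/-!
The `u_i` commute by one of the defining relations, so the point is that they are algebraically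
independent over `K[ħ]`. This follows from a representation of the algebra in which they act as
multiplications by independent variables.

Let `F` be the field of rational functions in `u_1, …, u_n` over `K[ħ]`, and let a weight be a
sequence of characters `χ_i`, `i ∈ ℤ`, of `μ_ℓ(K)` with `χ_{i+n}(ξ) = ξ χ_i(ξ)`, so that a weight
prescribes values `χ_i(ζ)` of the `t_i` that obey `t_{i+n} = ζ t_i`. The algebra acts on the `F`-valued
functions on the weights. The extended affine symmetric group, of the bijections `g` of `ℤ` with
`g (i + n) = g i + n`, acts on these functions by algebra automorphisms with `g u_i = u_{g i}` and
`g t_i = t_{g i}` (`funAct`); let `π` be the action of the shift `i ↦ i + 1` and `s_j` that of the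
reflection which exchanges `j` and `j + 1` modulo `n`. Then

* `u_i` and the diagonal matrices act by multiplication;
* `(j, j + 1)` acts by the Demazure–Lusztig operator `f_j + (1 - f_j) s_j`, where
  `f_j = -k (∑_q t_j^q t_{j+1}^{-q}) / (u_j - u_{j+1})` (`reflOp`);
* `τ` acts by `π⁻¹` and `σ` by `(u_1 + p(t_1)) π` (`freeRep`).

The operators of the transpositions satisfy the Coxeter relations (`coxeterRelations_reflOp`); the
braid relation comes down to `f_{ab} f_{bc} = f_{ac} (f_{ab} + f_{bc})` (`hFun_mul_hFun`). The Coxeter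
presentation of the symmetric group (`CoxeterRelations.exists_permHom`) then gives an action of the
whole group `Γ`. The remaining relations are identities between automorphisms and functions
(`freeRep_eq_of_rel`). The most interesting one is the last (`freeRep_last`), which rests on the
equality of the affine reflections of indices `0` and `n`.

A polynomial in the `u_i` takes the constant function `1` to itself, so it acts by zero only if it is
zero.
-/

namespace DunklOpdam

/-! ### The Coxeter presentation of the symmetric group -/

/-- The elements `a 0, …, a (r - 1)` satisfy the Coxeter relations of type `A_r`. -/
structure CoxeterRelations {N : Type*} [Monoid N] (a : ℕ → N) (r : ℕ) : Prop where
  sq : ∀ i < r, a i * a i = 1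
  braid : ∀ i, i + 1 < r → a i * a (i + 1) * a i = a (i + 1) * a i * a (i + 1)
  comm : ∀ i j, i + 1 < j → j < r → a i * a j = a j * a i

/-- The descending word `a m * a (m - 1) * ⋯ * a (m - j + 1)` with `j` letters. -/
def descWord {N : Type*} [Monoid N] (a : ℕ → N) (m : ℕ) : ℕ → N
  | 0 => 1
  | j + 1 => descWord a m j * a (m - j)

section Coxeter

variable {N : Type*} [Monoid N] {a : ℕ → N} {r : ℕ}

theorem CoxeterRelations.mul_descWord_of_lt (ha : CoxeterRelations a r) {m : ℕ} (hm : m < r)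
    (i j : ℕ) (hij : i + j < m) : a i * descWord a m j = descWord a m j * a i := by
  induction j with
  | zero => simp [descWord]
  | succ j ih =>
    rw [descWord, ← mul_assoc, ih (by omega), mul_assoc, ha.comm i (m - j) (by omega) (by omega),
      mul_assoc]

/-- A letter of a descending word that is not its last one moves to the left of the word with its
index lowered by one: the braid relation is used once. -/
theorem CoxeterRelations.descWord_mul_letter (ha : CoxeterRelations a r) {m : ℕ} (hm : m < r)
    (t j : ℕ) (htj : t + 2 ≤ j) (hj : j ≤ m + 1) :
    descWord a m j * a (m - t) = a (m - t - 1) * descWord a m j := by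
  induction j, htj using Nat.le_induction with
  | base =>
    have hb := ha.braid (m - t - 1) (by omega)
    rw [show m - t - 1 + 1 = m - t by omega] at hb
    rw [descWord, descWord, show m - (t + 1) = m - t - 1 by omega, mul_assoc, mul_assoc,
      ← mul_assoc (a (m - t)), ← hb, mul_assoc, ← mul_assoc,
      ← ha.mul_descWord_of_lt hm (m - t - 1) t (by omega)]
    simp only [mul_assoc]
  | succ j hj' ih =>
    rw [descWord, mul_assoc, ha.comm (m - j) (m - t) (by omega) (by omega), ← mul_assoc,
      ih (by omega), mul_assoc]

/-- Every product of the letters `a 0, …, a m` is a product of the letters `a 0, …, a (m - 1)`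
times one of the `m + 2` descending words that start with `a m`. -/
theorem CoxeterRelations.exists_eq_mul_descWord (ha : CoxeterRelations a r) {m : ℕ} (hm : m < r)
    {x : N} (hx : x ∈ Submonoid.closure (a '' Set.Iio (m + 1))) :
    ∃ y ∈ Submonoid.closure (a '' Set.Iio m), ∃ j ≤ m + 1, x = y * descWord a m j := by
  induction hx using Submonoid.closure_induction_right with
  | one => exact ⟨1, one_mem _, 0, by omega, by simp [descWord]⟩
  | mul_right x hx b hb ih =>
    obtain ⟨y, hy, j, hj, rfl⟩ := ih
    obtain ⟨i, hi, rfl⟩ := hb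
    rw [Set.mem_Iio] at hi
    rcases lt_trichotomy (i + j) m with h | h | h
    · refine ⟨y * a i, mul_mem hy (Submonoid.subset_closure ⟨i, ?_, rfl⟩), j, hj, ?_⟩
      · rw [Set.mem_Iio]; omega
      · rw [mul_assoc, ← ha.mul_descWord_of_lt hm i j h, mul_assoc]
    · refine ⟨y, hy, j + 1, by omega, ?_⟩
      rw [descWord, show m - j = i by omega, mul_assoc]
    · obtain ⟨j, rfl⟩ : ∃ j', j = j' + 1 := ⟨j - 1, by omega⟩
      by_cases h1 : i + j = m
      · refine ⟨y, hy, j, by omega, ?_⟩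
        rw [descWord, show m - j = i by omega, mul_assoc, mul_assoc, ha.sq i (by omega), mul_one]
      · refine ⟨y * a (i - 1), mul_mem hy (Submonoid.subset_closure ⟨i - 1, ?_, rfl⟩), j + 1, hj,
          ?_⟩
        · rw [Set.mem_Iio]; omega
        · have := ha.descWord_mul_letter hm (m - i) (j + 1) (by omega) hj
          rw [show m - (m - i) = i by omega] at this
          rw [mul_assoc, this, mul_assoc]

end Coxeter

section Presentation

variable {M : Type*} [Monoid M]

/-- The pairs of an adjacent transposition and the element it is to be sent to; they generate the
graph of the homomorphism of `CoxeterRelations.exists_permHom`. -/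
def graphGen (g : ℕ → M) (i : ℕ) : Equiv.Perm ℕ × M := (Equiv.swap i (i + 1), g i)

theorem CoxeterRelations.graphGen {g : ℕ → M} {r : ℕ} (hg : CoxeterRelations g r) :
    CoxeterRelations (graphGen g) r where
  sq i hi := Prod.ext (Equiv.swap_mul_self _ _) (hg.sq i hi)
  braid i hi := by
    refine Prod.ext (Equiv.ext fun x => ?_) (hg.braid i hi)
    simp only [DunklOpdam.graphGen, Prod.mk_mul_mk, Equiv.Perm.mul_apply, Equiv.swap_apply_def]
    grind
  comm i j hij hj := by
    refine Prod.ext (Equiv.ext fun x => ?_) (hg.comm i j hij hj)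
    simp only [DunklOpdam.graphGen, Prod.mk_mul_mk, Equiv.Perm.mul_apply, Equiv.swap_apply_def]
    grind

theorem fst_apply_of_mem_closure_graphGen (g : ℕ → M) {m : ℕ} {x : Equiv.Perm ℕ × M}
    (hx : x ∈ Submonoid.closure (graphGen g '' Set.Iio m)) : x.1 (m + 1) = m + 1 := by
  induction hx using Submonoid.closure_induction with
  | mem x hx =>
    obtain ⟨i, hi, rfl⟩ := hx
    rw [Set.mem_Iio] at hi
    exact Equiv.swap_apply_of_ne_of_ne (by omega) (by omega)
  | one => rfl
  | mul x y _ _ hx hy => rw [Prod.fst_mul, Equiv.Perm.mul_apply, hy, hx]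

theorem fst_descWord_graphGen_apply (g : ℕ → M) (m j : ℕ) (hj : j ≤ m + 1) :
    (descWord (graphGen g) m j).1 (m + 1 - j) = m + 1 := by
  induction j with
  | zero => rfl
  | succ j ih =>
    rw [descWord, Prod.fst_mul, Equiv.Perm.mul_apply, show m + 1 - (j + 1) = m - j by omega]
    change (descWord (DunklOpdam.graphGen g) m j).1 (Equiv.swap (m - j) (m - j + 1) (m - j)) = _
    rw [Equiv.swap_apply_left, show m - j + 1 = m + 1 - j by omega, ih (by omega)]

/-- The submonoid generated by the pairs `graphGen g i` is the graph of a function: its only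
element over the identity permutation is the identity. A descending word moves `m + 1`, unless it
is empty, while the shorter letters fix it. -/
theorem CoxeterRelations.eq_one_of_fst_eq_one {g : ℕ → M} {r : ℕ} (hg : CoxeterRelations g r)
    {x : Equiv.Perm ℕ × M} (hx : x ∈ Submonoid.closure (DunklOpdam.graphGen g '' Set.Iio r))
    (h1 : x.1 = 1) : x = 1 := by
  have key : ∀ m ≤ r, ∀ x ∈ Submonoid.closure (DunklOpdam.graphGen g '' Set.Iio m),
      x.1 = 1 → x = 1 := by
    intro m
    induction m with
    | zero =>
      intro _ x hx _
      simpa using hx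
    | succ m ih =>
      intro hm x hx h1
      obtain ⟨y, hy, j, hj, rfl⟩ := hg.graphGen.exists_eq_mul_descWord (by omega) hx
      have h2 : (y * descWord (DunklOpdam.graphGen g) m j).1 (m + 1 - j) = m + 1 := by
        rw [Prod.fst_mul, Equiv.Perm.mul_apply, fst_descWord_graphGen_apply g m j hj,
          fst_apply_of_mem_closure_graphGen g hy]
      rw [h1, Equiv.Perm.one_apply] at h2
      obtain rfl : j = 0 := by omega
      rw [descWord, mul_one] at h1 ⊢
      exact ih (by omega) y hy h1
  exact key r le_rfl x hx h1

theorem viaEmbedding_swap (n i : ℕ) (hi : i + 1 < n) :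
    Equiv.Perm.viaEmbeddingHom Fin.valEmbedding
      (Equiv.swap (⟨i, by omega⟩ : Fin n) ⟨i + 1, hi⟩) = Equiv.swap i (i + 1) := by
  ext x
  rw [Equiv.Perm.viaEmbeddingHom_apply]
  by_cases hx : x < n
  · refine (Equiv.Perm.viaEmbedding_apply _ Fin.valEmbedding (⟨x, hx⟩ : Fin n)).trans ?_
    simp only [Equiv.swap_apply_def, Fin.valEmbedding_apply, Fin.ext_iff]
    grind
  · rw [Equiv.Perm.viaEmbedding_apply_of_notMem, Equiv.swap_apply_of_ne_of_ne] <;>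
      simp <;> omega

theorem perm_induction_adjacent {n : ℕ} {P : Equiv.Perm (Fin n) → Prop}
    (hswap : ∀ i (hi : i + 1 < n), P (Equiv.swap ⟨i, by omega⟩ ⟨i + 1, hi⟩)) (h1 : P 1)
    (hmul : ∀ x y, P x → P y → P (x * y)) (w : Equiv.Perm (Fin n)) : P w := by
  cases n with
  | zero => rwa [Subsingleton.elim w 1]
  | succ n =>
    have hw : w ∈ Submonoid.closure
        (Set.range fun i : Fin n => Equiv.swap i.castSucc i.succ) := by
      rw [Equiv.Perm.mclosure_swap_castSucc_succ]; trivial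
    induction hw using Submonoid.closure_induction with
    | mem x hx =>
      obtain ⟨i, rfl⟩ := hx
      exact hswap i (by omega)
    | one => exact h1
    | mul x y _ _ hx hy => exact hmul x y hx hy

/-- The Coxeter presentation of the symmetric group: elements of a monoid that satisfy the Coxeter
relations of type `A` are the images of the adjacent transpositions under a homomorphism. -/
theorem CoxeterRelations.exists_permHom {g : ℕ → M} {n : ℕ} (hg : CoxeterRelations g (n - 1)) :
    ∃ φ : Equiv.Perm (Fin n) →* M, ∀ i (hi : i + 1 < n),
      φ (Equiv.swap ⟨i, by omega⟩ ⟨i + 1, hi⟩) = g i := by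
  set ι := Equiv.Perm.viaEmbeddingHom (Fin.valEmbedding (n := n)) with hι
  set H := Submonoid.closure (DunklOpdam.graphGen g '' Set.Iio (n - 1)) with hH
  have hgen : ∀ i (hi : i + 1 < n),
      (ι (Equiv.swap ⟨i, by omega⟩ ⟨i + 1, hi⟩), g i) ∈ H := by
    intro i hi
    rw [hι, viaEmbedding_swap n i hi]
    exact Submonoid.subset_closure ⟨i, by rw [Set.mem_Iio]; omega, rfl⟩
  have hmul : ∀ {x y a b}, (ι x, a) ∈ H → (ι y, b) ∈ H → (ι (x * y), a * b) ∈ H := by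
    intro x y a b ha hb
    rw [map_mul, ← Prod.mk_mul_mk]
    exact H.mul_mem ha hb
  have hex : ∀ w : Equiv.Perm (Fin n), ∃ m, (ι w, m) ∈ H := by
    refine perm_induction_adjacent (fun i hi => ⟨g i, hgen i hi⟩)
      ⟨1, by rw [map_one]; exact one_mem _⟩ ?_
    rintro x y ⟨a, ha⟩ ⟨b, hb⟩
    exact ⟨a * b, hmul ha hb⟩
  have hinv : ∀ w a b, (ι w, a) ∈ H → (ι w⁻¹, b) ∈ H → a * b = 1 := by
    intro w a b ha hb
    exact congrArg Prod.snd (hg.eq_one_of_fst_eq_one (hmul ha hb) (by simp))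
  have huniq : ∀ w a b, (ι w, a) ∈ H → (ι w, b) ∈ H → a = b := by
    intro w a b ha hb
    obtain ⟨c, hc⟩ := hex w⁻¹
    have h1 := hinv w a c ha hc
    have h2 := hinv w⁻¹ c b hc (by rwa [inv_inv])
    exact left_inv_eq_right_inv h1 h2
  choose f hf using hex
  refine ⟨⟨⟨f, ?_⟩, ?_⟩, ?_⟩
  · exact huniq 1 (f 1) 1 (hf 1) (by rw [map_one]; exact one_mem H)
  · intro x y
    refine huniq (x * y) (f (x * y)) (f x * f y) (hf (x * y)) ?_
    exact hmul (hf x) (hf y)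
  · exact fun i hi => huniq _ (f _) (g i) (hf _) (hgen i hi)

end Presentation

/-! ### Affine permutations -/

/-- The extended affine symmetric group: the bijections `g` of `ℤ` with `g (i + n) = g i + n`. -/
abbrev AffPerm (n : ℕ) : Type := AddConstEquiv ℤ ℤ (n : ℤ) (n : ℤ)

section Index

variable (n : ℕ) [NeZero n]

theorem pos_val (i : ℤ) : ((pos n i : ℕ) : ℤ) = (i - 1) % n := by
  have hn : (n : ℤ) ≠ 0 := by exact_mod_cast NeZero.ne n
  exact Int.toNat_of_nonneg (Int.emod_nonneg (i - 1) hn)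

theorem pos_add_mul_turns (i : ℤ) : ((pos n i : ℕ) : ℤ) + 1 + turns n i * n = i := by
  have := Int.emod_add_mul_ediv (i - 1) n
  rw [pos_val, turns, mul_comm]
  linarith

theorem pos_add (i : ℤ) : pos n (i + n) = pos n i := by
  apply Fin.ext
  zify
  rw [pos_val, pos_val, show i + n - 1 = i - 1 + n by ring, Int.add_emod_right]

theorem turns_add (i : ℤ) : turns n (i + n) = turns n i + 1 := by
  have hn : (n : ℤ) ≠ 0 := by exact_mod_cast NeZero.ne n
  rw [turns, turns, show i + n - 1 = i - 1 + n by ring, Int.add_ediv_of_dvd_right dvd_rfl,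
    Int.ediv_self hn]

omit [NeZero n] in
theorem turns_of_mem {i : ℤ} (h1 : 1 ≤ i) (h2 : i ≤ n) : turns n i = 0 :=
  Int.ediv_eq_zero_of_lt (by omega) (by omega)

theorem pos_val_of_mem {i : ℤ} (h1 : 1 ≤ i) (h2 : i ≤ n) : ((pos n i : ℕ) : ℤ) = i - 1 := by
  have := pos_add_mul_turns n i
  rw [turns_of_mem n h1 h2] at this
  omega

theorem pos_val_add_one (i : Fin n) : pos n ((i : ℕ) + 1 : ℤ) = i := by
  apply Fin.ext
  zify
  rw [pos_val_of_mem n (by omega) (by omega)]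
  omega

end Index

theorem AffPerm.apply_add_mul {n : ℕ} (g : AffPerm n) (i q : ℤ) : g (i + q * n) = g i + q * n := by
  simpa using AddConstMapClass.map_add_zsmul g i q

/-- Affine permutations are determined by their values on `1, …, n`. -/
theorem AffPerm.ext_of_mem {n : ℕ} [NeZero n] {g h : AffPerm n}
    (H : ∀ i : ℤ, 1 ≤ i → i ≤ n → g i = h i) : g = h := by
  refine AddConstEquiv.ext fun i => ?_
  rw [← pos_add_mul_turns n i, g.apply_add_mul, h.apply_add_mul, H _ (by omega) (by omega)]

/-- The shift `i ↦ i + 1`. -/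
def shift (n : ℕ) : AffPerm n where
  toEquiv := Equiv.addRight 1
  map_add_const' i := by simp; ring

@[simp] theorem shift_apply (n : ℕ) (i : ℤ) : shift n i = i + 1 := rfl

@[simp] theorem shift_inv_apply (n : ℕ) (i : ℤ) : (shift n)⁻¹ i = i - 1 := rfl

/-- The map underlying the affine reflection `refl n j`. -/
def reflFun (n : ℕ) (j i : ℤ) : ℤ :=
  if (n : ℤ) ∣ i - j then i + 1 else if (n : ℤ) ∣ i - (j + 1) then i - 1 else i

theorem reflFun_involutive {n : ℕ} (hn : 2 ≤ n) (j : ℤ) : Function.Involutive (reflFun n j) := by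
  intro i
  have h1 : ∀ m : ℤ, (n : ℤ) ∣ m → ¬ (n : ℤ) ∣ m + 1 := by
    intro m h h'
    have := Int.le_of_dvd one_pos ((dvd_add_right h).1 h')
    omega
  unfold reflFun
  by_cases hi : (n : ℤ) ∣ i - j
  · have h2 : ¬ (n : ℤ) ∣ i + 1 - j := by
      rw [show i + 1 - j = i - j + 1 by ring]; exact h1 _ hi
    rw [if_pos hi, if_neg h2, if_pos (by rwa [show i + 1 - (j + 1) = i - j by ring])]
    ring
  · by_cases hi' : (n : ℤ) ∣ i - (j + 1)
    · rw [if_neg hi, if_pos hi', if_pos (by rwa [show i - 1 - j = i - (j + 1) by ring])]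
      ring
    · rw [if_neg hi, if_neg hi', if_neg hi, if_neg hi']

/-- The affine reflection that exchanges `j + n q` and `j + 1 + n q` for every `q`. -/
def refl {n : ℕ} (hn : 2 ≤ n) (j : ℤ) : AffPerm n where
  toEquiv := (reflFun_involutive hn j).toPerm
  map_add_const' i := by
    change reflFun n j (i + n) = reflFun n j i + n
    have h (m : ℤ) : (n : ℤ) ∣ i + n - m ↔ (n : ℤ) ∣ i - m := by
      rw [show i + n - m = i - m + n by ring, dvd_add_self_right]
    simp only [reflFun, h]
    split_ifs <;> ring

theorem refl_apply {n : ℕ} (hn : 2 ≤ n) (j i : ℤ) : refl hn j i = reflFun n j i := rfl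

theorem shift_mul_refl {n : ℕ} (hn : 2 ≤ n) (j : ℤ) :
    shift n * refl hn j = refl hn (j + 1) * shift n := by
  ext i
  change reflFun n j i + 1 = reflFun n (j + 1) (i + 1)
  simp only [reflFun, add_sub_add_right_eq_sub]
  split_ifs <;> ring

theorem refl_add {n : ℕ} (hn : 2 ≤ n) (j : ℤ) : refl hn (j + n) = refl hn j := by
  ext i
  simp only [refl_apply, reflFun, show i - (j + n) = i - j - n by ring,
    show i - (j + n + 1) = i - (j + 1) - n by ring, dvd_sub_self_right]

theorem refl_apply_left {n : ℕ} (hn : 2 ≤ n) (j : ℤ) : refl hn j j = j + 1 := by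
  simp [refl_apply, reflFun]

theorem refl_mul_self {n : ℕ} (hn : 2 ≤ n) (j : ℤ) : refl hn j * refl hn j = 1 := by
  ext i
  exact reflFun_involutive hn j i

theorem refl_apply_right {n : ℕ} (hn : 2 ≤ n) (j : ℤ) : refl hn j (j + 1) = j := by
  rw [← refl_apply_left hn j]
  exact DFunLike.congr_fun (refl_mul_self hn j) j

theorem refl_apply_of_mem {n : ℕ} (hn : 2 ≤ n) {i j : ℤ} (hi : 1 ≤ i) (hi' : i ≤ n) (hj : 1 ≤ j)
    (hj' : j + 1 ≤ n) :
    refl hn j i = if i = j then i + 1 else if i = j + 1 then i - 1 else i := by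
  have h (m : ℤ) (hm : 1 ≤ m) (hm' : m ≤ n) : (n : ℤ) ∣ i - m ↔ i = m := by
    refine ⟨fun h => ?_, fun h => by simp [h]⟩
    have := Int.eq_zero_of_abs_lt_dvd h (abs_lt.2 ⟨by omega, by omega⟩)
    omega
  simp only [refl_apply, reflFun, h j hj (by omega), h (j + 1) (by omega) hj']

/-- The affine reflection of index `j` acts on `1, …, n` as the transposition `(j, j + 1)`. -/
theorem pos_refl_apply {n : ℕ} [NeZero n] (hn : 2 ≤ n) {j : ℤ} (hj : 1 ≤ j) (hj' : j + 1 ≤ n)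
    (i : Fin n) : refl hn j ((i : ℕ) + 1) =
      (Equiv.swap (pos n j) (pos n (j + 1)) i : ℕ) + 1 := by
  have h1 := pos_val_of_mem n hj (by omega)
  have h2 := pos_val_of_mem n (i := j + 1) (by omega) hj'
  rw [refl_apply_of_mem hn (by omega) (by omega) hj hj', Equiv.swap_apply_def]
  simp only [Fin.ext_iff, apply_ite (Fin.val (n := n)), apply_ite (Nat.cast (R := ℤ))]
  grind

theorem refl_braid {n : ℕ} [NeZero n] (hn : 2 ≤ n) {j : ℤ} (hj : 1 ≤ j) (hj' : j + 2 ≤ n) :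
    refl hn j * refl hn (j + 1) * refl hn j =
      refl hn (j + 1) * refl hn j * refl hn (j + 1) := by
  refine AffPerm.ext_of_mem fun i hi hi' => ?_
  have A (m : ℤ) (hm : 1 ≤ m) (hm' : m ≤ n) := refl_apply_of_mem hn hm hm' hj (by omega)
  have B (m : ℤ) (hm : 1 ≤ m) (hm' : m ≤ n) :=
    refl_apply_of_mem hn hm hm' (j := j + 1) (by omega) (by omega)
  change refl hn j (refl hn (j + 1) (refl hn j i)) =
    refl hn (j + 1) (refl hn j (refl hn (j + 1) i))
  grind (splits := 20)

theorem refl_comm {n : ℕ} [NeZero n] (hn : 2 ≤ n) {j k : ℤ} (hj : 1 ≤ j) (hjk : j + 1 < k)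
    (hk : k + 1 ≤ n) : refl hn j * refl hn k = refl hn k * refl hn j := by
  refine AffPerm.ext_of_mem fun i hi hi' => ?_
  have A (m : ℤ) (hm : 1 ≤ m) (hm' : m ≤ n) := refl_apply_of_mem hn hm hm' hj (by omega)
  have B (m : ℤ) (hm : 1 ≤ m) (hm' : m ≤ n) :=
    refl_apply_of_mem hn hm hm' (j := k) (by omega) (by omega)
  change refl hn j (refl hn k i) = refl hn k (refl hn j i)
  grind (splits := 20)

/-! ### Functions on the weights -/

section Functions

variable (n ℓ : ℕ) [NeZero n] (K : Type*) [Field K]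

/-- The element `u_i`, for an integer `i`, of the polynomial ring in `u_1, …, u_n` over `K[ħ]`. -/
noncomputable def uPoly (i : ℤ) : MvPolynomial (Fin n) (Polynomial K) :=
  MvPolynomial.X (pos n i) - MvPolynomial.C ((turns n i : Polynomial K) * hbar K)

theorem uPoly_add_mul (i q : ℤ) :
    uPoly n K (i + q * n) = uPoly n K i - MvPolynomial.C ((q : Polynomial K) * hbar K) := by
  have key (i : ℤ) : uPoly n K (i + n) = uPoly n K i - MvPolynomial.C (hbar K) := by
    rw [uPoly, uPoly, pos_add, turns_add]
    push_cast
    simp only [map_add, map_mul, map_one, add_mul]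
    ring
  induction q with
  | zero => simp
  | succ q ih =>
    rw [show i + ((q : ℤ) + 1) * n = i + q * n + n by ring, key, ih]
    push_cast
    simp only [map_add, map_mul, map_one, add_mul]
    ring
  | pred q ih =>
    have := key (i + (-(q : ℤ) - 1) * n)
    rw [show i + (-(q : ℤ) - 1) * n + n = i + -(q : ℤ) * n by ring, ih] at this
    rw [eq_comm, sub_eq_iff_eq_add] at this
    rw [this]
    push_cast
    simp only [map_sub, map_neg, map_mul, map_one, sub_mul, neg_mul]
    ring

end Functions

/-! ### Rational functions of `u_1, …, u_n` on the set of weights -/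

section Functions

variable (n ℓ : ℕ) [NeZero n] (K : Type*) [Field K]

/-- The substitution `u_i ↦ u_{g i}` in polynomials. -/
noncomputable def polySubst (g : AffPerm n) :
    MvPolynomial (Fin n) (Polynomial K) →ₐ[Polynomial K] MvPolynomial (Fin n) (Polynomial K) :=
  MvPolynomial.aeval fun i => uPoly n K (g ((i : ℕ) + 1))

variable {n} in
theorem polySubst_uPoly (g : AffPerm n) (i : ℤ) :
    polySubst n K g (uPoly n K i) = uPoly n K (g i) := by
  conv_rhs => rw [← pos_add_mul_turns n i, g.apply_add_mul, uPoly_add_mul]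
  rw [uPoly, map_sub, polySubst, MvPolynomial.aeval_X, ← MvPolynomial.algebraMap_eq,
    AlgHom.commutes]

theorem uPoly_of_fin (i : Fin n) : uPoly n K ((i : ℕ) + 1) = MvPolynomial.X i := by
  rw [uPoly, pos_val_add_one, turns_of_mem n (by omega) (by omega)]
  simp

variable {n} in
theorem polySubst_mul (g h : AffPerm n) :
    polySubst n K (g * h) = (polySubst n K g).comp (polySubst n K h) := by
  refine MvPolynomial.algHom_ext fun i => ?_
  rw [← uPoly_of_fin, AlgHom.comp_apply, polySubst_uPoly, polySubst_uPoly, polySubst_uPoly]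
  rfl

theorem polySubst_one : polySubst n K 1 = AlgHom.id _ _ := by
  refine MvPolynomial.algHom_ext fun i => ?_
  rw [← uPoly_of_fin, polySubst_uPoly]
  rfl

/-- The action of affine permutations on polynomials in `u_1, …, u_n`, with `g u_i = u_{g i}`. -/
noncomputable def polyAct : AffPerm n →*
    (MvPolynomial (Fin n) (Polynomial K) ≃ₐ[Polynomial K] MvPolynomial (Fin n) (Polynomial K)) where
  toFun g := AlgEquiv.ofAlgHom (polySubst n K g) (polySubst n K g⁻¹)
    (by rw [← polySubst_mul, mul_inv_cancel, polySubst_one])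
    (by rw [← polySubst_mul, inv_mul_cancel, polySubst_one])
  map_one' := AlgEquiv.ext fun x => DFunLike.congr_fun (polySubst_one n K) x
  map_mul' g h := AlgEquiv.ext fun x => DFunLike.congr_fun (polySubst_mul K g h) x

/-- The field of rational functions in `u_1, …, u_n` over `K[ħ]`. -/
abbrev RatFun : Type _ := FractionRing (MvPolynomial (Fin n) (Polynomial K))

/-- The rational function `u_i`, for an integer `i`. -/
noncomputable def uRat (i : ℤ) : RatFun n K := algebraMap _ _ (uPoly n K i)

/-- The action of affine permutations on rational functions. -/
noncomputable def ratAct : AffPerm n →* (RatFun n K →ₐ[Polynomial K] RatFun n K) where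
  toFun g := (IsFractionRing.algEquivOfAlgEquiv (polyAct n K g) : RatFun n K ≃ₐ[_] RatFun n K)
  map_one' := by
    refine AlgHom.ext fun x => ?_
    obtain ⟨x, y, -, rfl⟩ :=
      IsFractionRing.div_surjective (MvPolynomial (Fin n) (Polynomial K)) x
    simp
  map_mul' g h := by
    refine AlgHom.ext fun x => ?_
    obtain ⟨x, y, -, rfl⟩ :=
      IsFractionRing.div_surjective (MvPolynomial (Fin n) (Polynomial K)) x
    simp

variable {n} in
theorem ratAct_uRat (g : AffPerm n) (i : ℤ) : ratAct n K g (uRat n K i) = uRat n K (g i) := by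
  rw [uRat, uRat, ← polySubst_uPoly]
  exact IsFractionRing.algEquivOfAlgEquiv_algebraMap _ _

theorem uRat_add (i : ℤ) :
    uRat n K (i + n) = uRat n K i - algebraMap (Polynomial K) _ (hbar K) := by
  have := uPoly_add_mul n K i 1
  rw [one_mul] at this
  rw [uRat, uRat, this, map_sub, IsScalarTower.algebraMap_apply (Polynomial K)
    (MvPolynomial (Fin n) (Polynomial K)) (RatFun n K), MvPolynomial.algebraMap_eq]
  simp

theorem uRat_ne {i j : ℤ} (h : pos n i ≠ pos n j) : uRat n K i ≠ uRat n K j := by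
  intro H
  have H := IsFractionRing.injective (MvPolynomial (Fin n) (Polynomial K)) (RatFun n K) H
  -- The coefficients of `u_{pos n i}` are `1` and `0`.
  have := congrArg (MvPolynomial.coeff (Finsupp.single (pos n i) 1)) H
  rw [uPoly, uPoly, MvPolynomial.coeff_sub, MvPolynomial.coeff_sub, MvPolynomial.coeff_C,
    MvPolynomial.coeff_C, MvPolynomial.coeff_X, MvPolynomial.coeff_X] at this
  have h0 : (0 : Fin n →₀ ℕ) ≠ Finsupp.single (pos n i) 1 := by simp [eq_comm]
  have h1 : Finsupp.single (pos n j) 1 ≠ Finsupp.single (pos n i) 1 := by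
    intro h'
    exact h (Finsupp.single_left_injective one_ne_zero h').symm
  rw [if_neg h0, if_neg h0, if_neg h1] at this
  simp at this

/-- A weight: a sequence `χ_i`, `i ∈ ℤ`, of characters of `μ_ℓ(K)` such that `χ_{i+n}(ξ) = ξ χ_i(ξ)`.
The element `t_i` takes the value `χ_i(ζ)` at this weight, in accordance with
`t_{i+n} = ζ t_i`. -/
structure Weight where
  /-- The characters `χ_i`. -/
  char : ℤ → rootsOfUnity ℓ K →* K
  char_add : ∀ i ξ, char (i + n) ξ = ((ξ : Kˣ) : K) * char i ξ

variable {n ℓ K}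

omit [NeZero n] in
theorem Weight.char_add_mul (χ : Weight n ℓ K) (i q : ℤ) (ξ : rootsOfUnity ℓ K) :
    χ.char (i + q * n) ξ = (((ξ : Kˣ) ^ q : Kˣ) : K) * χ.char i ξ := by
  induction q with
  | zero => simp
  | succ q ih =>
    rw [show i + ((q : ℤ) + 1) * n = i + q * n + n by ring, χ.char_add, ih, zpow_add_one]
    push_cast
    ring
  | pred q ih =>
    have := χ.char_add (i + (-(q : ℤ) - 1) * n) ξ
    rw [show i + (-(q : ℤ) - 1) * n + n = i + -(q : ℤ) * n by ring, ih] at this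
    rw [zpow_sub_one, Units.val_mul, mul_right_comm, this, mul_right_comm, Units.mul_inv, one_mul]

omit [NeZero n] in
theorem Weight.char_add_inj (χ : Weight n ℓ K) {a b : ℤ} :
    χ.char (a + n) = χ.char (b + n) ↔ χ.char a = χ.char b := by
  simp only [MonoidHom.ext_iff, χ.char_add]
  refine forall_congr' fun ξ => ?_
  rw [mul_right_inj' (Units.ne_zero _)]

/-- The weight `i ↦ χ_{g i}`. -/
def Weight.comp (χ : Weight n ℓ K) (g : AffPerm n) : Weight n ℓ K :=
  ⟨fun i => χ.char (g i), fun i ξ => by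
    have := g.apply_add_mul i 1
    rw [one_mul] at this
    simp only [this, χ.char_add]⟩

omit [NeZero n] in
theorem Weight.comp_char (χ : Weight n ℓ K) (g : AffPerm n) (i : ℤ) :
    (χ.comp g).char i = χ.char (g i) := rfl

instance : Nonempty (Weight n ℓ K) :=
  ⟨⟨fun i =>
      { toFun ξ := (((ξ : Kˣ) ^ turns n i : Kˣ) : K)
        map_one' := by simp
        map_mul' a b := by simp [mul_zpow] }, fun i ξ => by
      simp only [MonoidHom.coe_mk, OneHom.coe_mk, turns_add, zpow_add_one]
      push_cast
      ring⟩⟩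

variable (n ℓ K) in
/-- The functions on the set of weights with values in the rational functions. -/
abbrev WeightFun : Type _ := Weight n ℓ K → RatFun n K

variable (n ℓ K) in
/-- The action of affine permutations on functions, with `g u_i = u_{g i}` and
`g t_i = t_{g i}`. -/
noncomputable def funAct :
    AffPerm n →* (WeightFun n ℓ K →ₐ[Polynomial K] WeightFun n ℓ K) where
  toFun g := AlgHom.pi fun χ : Weight n ℓ K =>
    (ratAct n K g).comp (Pi.evalAlgHom (Polynomial K) (fun _ : Weight n ℓ K => RatFun n K)
      (χ.comp g))
  map_one' := by
    ext f χ
    change ratAct n K 1 (f χ) = f χ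
    rw [map_one]
    rfl
  map_mul' g h := by
    ext f χ
    change ratAct n K (g * h) (f ((χ.comp g).comp h)) = _
    rw [map_mul]
    rfl

theorem funAct_apply (g : AffPerm n) (f : WeightFun n ℓ K) (χ : Weight n ℓ K) :
    funAct n ℓ K g f χ = ratAct n K g (f (χ.comp g)) := rfl

/-- The constants of `K` as rational functions. -/
noncomputable def constRat (n : ℕ) : K →+* RatFun n K :=
  (algebraMap (Polynomial K) _).comp Polynomial.C

@[simp] theorem ratAct_constRat (g : AffPerm n) (c : K) :
    ratAct n K g (constRat n c) = constRat n c := AlgHom.commutes _ _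

variable (ℓ K) in
/-- The function `u_i`. -/
noncomputable def uFun (i : ℤ) : WeightFun n ℓ K := fun _ => uRat n K i

/-- The function `t_i`. -/
noncomputable def tFun (ζ : rootsOfUnity ℓ K) (i : ℤ) : WeightFun n ℓ K :=
  fun χ => constRat n (χ.char i ζ)

theorem funAct_uFun (g : AffPerm n) (i : ℤ) : funAct n ℓ K g (uFun ℓ K i) = uFun ℓ K (g i) := by
  ext χ
  exact ratAct_uRat K g i

theorem funAct_tFun (ζ : rootsOfUnity ℓ K) (g : AffPerm n) (i : ℤ) :
    funAct n ℓ K g (tFun ζ i) = tFun ζ (g i) := by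
  ext χ
  exact ratAct_constRat g _

open scoped Classical in
/-- The function `-k (∑_q t_a^q t_b^{-q}) / (u_a - u_b)`. The sum is `ℓ` at the weights with
`χ_a = χ_b` and vanishes at the others. -/
noncomputable def hFun (k : Polynomial K) (a b : ℤ) : WeightFun n ℓ K := fun χ =>
  if χ.char a = χ.char b then -(ℓ * algebraMap _ _ k) / (uRat n K a - uRat n K b) else 0

theorem funAct_hFun (k : Polynomial K) (g : AffPerm n) (a b : ℤ) :
    funAct n ℓ K g (hFun k a b) = hFun k (g a) (g b) := by
  ext χ
  rw [funAct_apply, hFun, hFun, apply_ite (ratAct n K g)]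
  simp only [map_div₀, map_neg, map_mul, map_natCast, AlgHom.commutes, map_sub, ratAct_uRat,
    map_zero]
  rfl

theorem hFun_swap (k : Polynomial K) (a b : ℤ) :
    (hFun k b a : WeightFun n ℓ K) = -hFun k a b := by
  ext χ
  rw [Pi.neg_apply, hFun, hFun]
  by_cases h : χ.char a = χ.char b
  · rw [if_pos h, if_pos h.symm, ← neg_sub, div_neg]
  · rw [if_neg h, if_neg (fun h' => h h'.symm), neg_zero]

theorem hFun_add (k : Polynomial K) (a b : ℤ) :
    (hFun k (a + n) (b + n) : WeightFun n ℓ K) = hFun k a b := by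
  ext χ
  rw [hFun, hFun, uRat_add, uRat_add, sub_sub_sub_cancel_right]
  by_cases e : χ.char a = χ.char b
  · rw [if_pos e, if_pos (χ.char_add_inj.2 e)]
  · rw [if_neg e, if_neg (mt χ.char_add_inj.1 e)]

/-- The functional equation behind the braid relation. -/
theorem hFun_mul_hFun (k : Polynomial K) {a b c : ℤ} (hab : pos n a ≠ pos n b)
    (hbc : pos n b ≠ pos n c) (hac : pos n a ≠ pos n c) :
    (hFun k a b * hFun k b c : WeightFun n ℓ K) =
      hFun k a c * (hFun k a b + hFun k b c) := by
  ext χ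
  have h1 := sub_ne_zero.2 (uRat_ne n K hab)
  have h2 := sub_ne_zero.2 (uRat_ne n K hbc)
  have h3 := sub_ne_zero.2 (uRat_ne n K hac)
  simp only [hFun, Pi.mul_apply, Pi.add_apply]
  by_cases e1 : χ.char a = χ.char b
  · by_cases e2 : χ.char b = χ.char c
    · rw [if_pos e1, if_pos e2, if_pos (e1.trans e2)]
      field_simp
      ring
    · rw [if_neg e2, if_neg (fun h => e2 (e1.symm.trans h))]
      simp
  · by_cases e2 : χ.char b = χ.char c
    · rw [if_neg e1, if_neg (fun h : χ.char a = χ.char c => e1 (h.trans e2.symm))]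
      simp
    · rw [if_neg e1, if_neg e2]
      simp

end Functions

/-! ### Demazure–Lusztig operators -/

section Demazure

variable {A R : Type*} [CommRing A] [CommRing R] [Algebra A R]

/-- The operator `a + (1 - a) s` on a commutative algebra with an endomorphism `s`. -/
noncomputable def demazure (a : R) (s : R →ₐ[A] R) : Module.End A R :=
  Algebra.lmul A R a + Algebra.lmul A R (1 - a) * s.toLinearMap

theorem demazure_apply (a : R) (s : R →ₐ[A] R) (f : R) :
    demazure a s f = a * f + (1 - a) * s f := rfl

theorem demazure_mul_self {a : R} {s : R →ₐ[A] R} (hs : s * s = 1) (ha : s a = -a) :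
    demazure a s * demazure a s = 1 := by
  ext f
  have h : s (s f) = f := DFunLike.congr_fun hs f
  simp only [Module.End.mul_apply, demazure_apply, map_add, map_mul, map_sub, map_one, ha, h,
    Module.End.one_apply]
  ring

theorem demazure_comm {a b : R} {s t : R →ₐ[A] R} (hst : s * t = t * s) (hb : s b = b)
    (ha : t a = a) : demazure a s * demazure b t = demazure b t * demazure a s := by
  ext f
  have h : s (t f) = t (s f) := DFunLike.congr_fun hst f
  simp only [Module.End.mul_apply, demazure_apply, map_add, map_mul, map_sub, map_one, ha, hb, h]
  ring

/-- The braid relation for Demazure–Lusztig operators amounts to the equation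
`a b = c (a + b)` for their coefficients. -/
theorem demazure_braid {a b c : R} {s t : R →ₐ[A] R} (hs : s * s = 1) (ht : t * t = 1)
    (hst : s * t * s = t * s * t) (sa : s a = -a) (sb : s b = c) (sc : s c = b) (ta : t a = c)
    (tb : t b = -b) (tc : t c = a) (habc : a * b = c * (a + b)) :
    demazure a s * demazure b t * demazure a s = demazure b t * demazure a s * demazure b t := by
  ext f
  have h1 : s (s f) = f := DFunLike.congr_fun hs f
  have h2 : t (t f) = f := DFunLike.congr_fun ht f
  have h3 : s (t (s f)) = t (s (t f)) := DFunLike.congr_fun hst f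
  simp only [Module.End.mul_apply, demazure_apply, map_add, map_mul, map_sub, map_one,
    sa, sb, sc, ta, tb, tc, h1, h2, h3]
  linear_combination ((a - b) * f + (1 - a) * s f - (1 - b) * t f) * habc

theorem demazure_mul_lmul (a g : R) (s : R →ₐ[A] R) :
    demazure a s * Algebra.lmul A R g =
      Algebra.lmul A R (s g) * demazure a s + Algebra.lmul A R (a * (g - s g)) := by
  ext f
  simp only [Module.End.mul_apply, demazure_apply, LinearMap.add_apply, Algebra.coe_lmul_eq_mul,
    LinearMap.mul_apply', map_mul]
  ring

theorem toLinearMap_mul_lmul (s : R →ₐ[A] R) (g : R) :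
    s.toLinearMap * Algebra.lmul A R g = Algebra.lmul A R (s g) * s.toLinearMap := by
  ext f
  simp

theorem toLinearMap_mul_demazure {s t t' : R →ₐ[A] R} (h : s * t = t' * s) (a : R) :
    s.toLinearMap * demazure a t = demazure (s a) t' * s.toLinearMap := by
  ext f
  have h : s (t f) = t' (s f) := DFunLike.congr_fun h f
  simp [demazure_apply, h]

end Demazure

section Operators

variable {n ℓ : ℕ} [NeZero n] {K : Type*} [Field K]

variable (n ℓ K) in
/-- The operator by which the shift acts on functions. -/
noncomputable def shiftOp : Module.End (Polynomial K) (WeightFun n ℓ K) :=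
  (funAct n ℓ K (shift n)).toLinearMap

variable (n ℓ K) in
/-- The inverse of `shiftOp`. -/
noncomputable def shiftInvOp : Module.End (Polynomial K) (WeightFun n ℓ K) :=
  (funAct n ℓ K (shift n)⁻¹).toLinearMap

variable (n ℓ K) in
/-- The multiplication operators. -/
noncomputable abbrev mulOp :
    WeightFun n ℓ K →ₐ[Polynomial K] Module.End (Polynomial K) (WeightFun n ℓ K) :=
  Algebra.lmul (Polynomial K) (WeightFun n ℓ K)

variable (ℓ) in
/-- The operator by which the transposition `(j, j + 1)` acts. -/
noncomputable def reflOp (hn : 2 ≤ n) (k : Polynomial K) (j : ℤ) :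
    Module.End (Polynomial K) (WeightFun n ℓ K) :=
  demazure (hFun k j (j + 1)) (funAct n ℓ K (refl hn j))

theorem shiftOp_mul_shiftInvOp : shiftOp n ℓ K * shiftInvOp n ℓ K = 1 := by
  ext f : 1
  have := DFunLike.congr_fun (map_mul (funAct n ℓ K) (shift n) (shift n)⁻¹) f
  rw [mul_inv_cancel, map_one] at this
  exact this.symm

theorem shiftInvOp_mul_shiftOp : shiftInvOp n ℓ K * shiftOp n ℓ K = 1 := by
  ext f : 1
  have := DFunLike.congr_fun (map_mul (funAct n ℓ K) (shift n)⁻¹ (shift n)) f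
  rw [inv_mul_cancel, map_one] at this
  exact this.symm

theorem shiftOp_mul_mulOp (f : WeightFun n ℓ K) :
    shiftOp n ℓ K * mulOp n ℓ K f = mulOp n ℓ K (funAct n ℓ K (shift n) f) * shiftOp n ℓ K :=
  toLinearMap_mul_lmul _ _

theorem shiftInvOp_mul_mulOp (f : WeightFun n ℓ K) :
    shiftInvOp n ℓ K * mulOp n ℓ K f =
      mulOp n ℓ K (funAct n ℓ K (shift n)⁻¹ f) * shiftInvOp n ℓ K :=
  toLinearMap_mul_lmul _ _

theorem shiftOp_mul_reflOp (hn : 2 ≤ n) (k : Polynomial K) (j : ℤ) :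
    shiftOp n ℓ K * reflOp ℓ hn k j = reflOp ℓ hn k (j + 1) * shiftOp n ℓ K := by
  rw [shiftOp, reflOp, reflOp, toLinearMap_mul_demazure (t' := funAct n ℓ K (refl hn (j + 1))),
    funAct_hFun]
  · rfl
  · rw [← map_mul, ← map_mul, shift_mul_refl]

theorem reflOp_mul_shiftInvOp (hn : 2 ≤ n) (k : Polynomial K) (j : ℤ) :
    reflOp ℓ hn k j * shiftInvOp n ℓ K = shiftInvOp n ℓ K * reflOp ℓ hn k (j + 1) := by
  have := congrArg (fun x => shiftInvOp n ℓ K * x * shiftInvOp n ℓ K)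
    (shiftOp_mul_reflOp (ℓ := ℓ) hn k j)
  simp only [mul_assoc, shiftOp_mul_shiftInvOp, mul_one] at this
  rwa [← mul_assoc, shiftInvOp_mul_shiftOp, one_mul] at this

theorem reflOp_add (hn : 2 ≤ n) (k : Polynomial K) (j : ℤ) :
    reflOp ℓ hn k (j + n) = reflOp ℓ hn k j := by
  rw [reflOp, reflOp, refl_add, add_right_comm, hFun_add]

omit [NeZero n] in
theorem refl_apply_of_ne {i j : ℤ} (hn : 2 ≤ n) (hi : 1 ≤ i) (hi' : i ≤ n) (hj : 1 ≤ j)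
    (hj' : j + 1 ≤ n) (h1 : i ≠ j) (h2 : i ≠ j + 1) : refl hn j i = i := by
  rw [refl_apply_of_mem hn hi hi' hj hj', if_neg h1, if_neg h2]

theorem pos_ne {i j : ℤ} (hi : 1 ≤ i) (hi' : i ≤ n) (hj : 1 ≤ j) (hj' : j ≤ n) (h : i ≠ j) :
    pos n i ≠ pos n j := by
  intro H
  have h1 := pos_val_of_mem n hi hi'
  have h2 := pos_val_of_mem n hj hj'
  rw [H] at h1
  omega

/-- The sequence is indexed from `0`, the transpositions `(j, j + 1)` from `1`. -/
theorem coxeterRelations_reflOp (hn : 2 ≤ n) (k : Polynomial K) :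
    CoxeterRelations (fun i => reflOp ℓ hn k ((i : ℤ) + 1)) (n - 1) where
  sq i _ := by
    refine demazure_mul_self (by rw [← map_mul, refl_mul_self, map_one]) ?_
    rw [funAct_hFun, refl_apply_left, refl_apply_right, hFun_swap]
  braid i hi := by
    have e : ((i + 1 : ℕ) : ℤ) = i + 1 := by push_cast; rfl
    simp only [e]
    have hj : (1 : ℤ) ≤ (i : ℤ) + 1 := by omega
    have hj' : (i : ℤ) + 1 + 2 ≤ n := by omega
    generalize (i : ℤ) + 1 = j at hj hj'
    have s3 : refl hn j (j + 1 + 1) = j + 1 + 1 :=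
      refl_apply_of_ne hn (by omega) (by omega) hj (by omega) (by omega) (by omega)
    have t1 : refl hn (j + 1) j = j :=
      refl_apply_of_ne hn (by omega) (by omega) (by omega) (by omega) (by omega) (by omega)
    refine demazure_braid (c := hFun k j (j + 1 + 1)) ?_ ?_ ?_ ?_ ?_ ?_ ?_ ?_ ?_ ?_
    · rw [← map_mul, refl_mul_self, map_one]
    · rw [← map_mul, refl_mul_self, map_one]
    · simp only [← map_mul, refl_braid hn hj hj']
    · rw [funAct_hFun, refl_apply_left, refl_apply_right, hFun_swap]
    · rw [funAct_hFun, refl_apply_right, s3]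
    · rw [funAct_hFun, refl_apply_left, s3]
    · rw [funAct_hFun, refl_apply_left, t1]
    · rw [funAct_hFun, refl_apply_left, refl_apply_right, hFun_swap]
    · rw [funAct_hFun, refl_apply_right, t1]
    · refine hFun_mul_hFun k ?_ ?_ ?_ <;> apply pos_ne <;> omega
  comm i j hij hj := by
    refine demazure_comm ?_ ?_ ?_
    · rw [← map_mul, ← map_mul, refl_comm hn (by omega) (by omega) (by omega)]
    · rw [funAct_hFun, refl_apply_of_ne, refl_apply_of_ne] <;> omega
    · rw [funAct_hFun, refl_apply_of_ne, refl_apply_of_ne] <;> omega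

/-- The function by which the diagonal matrix `d` acts: its value at the weight `χ` is
`∏ i, χ_i(d_i)`. -/
noncomputable def diagFun : (Fin n → rootsOfUnity ℓ K) →* WeightFun n ℓ K where
  toFun d χ := ∏ i : Fin n, constRat n (χ.char ((i : ℕ) + 1) (d i))
  map_one' := by
    ext χ
    simp
  map_mul' d e := by
    ext χ
    simp [Finset.prod_mul_distrib]

omit [NeZero n] in
theorem diagFun_apply (d : Fin n → rootsOfUnity ℓ K) (χ : Weight n ℓ K) :
    diagFun d χ = ∏ i : Fin n, constRat n (χ.char ((i : ℕ) + 1) (d i)) := rfl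

omit [NeZero n] in
theorem diagFun_mulSingle (j : Fin n) (ξ : rootsOfUnity ℓ K) (χ : Weight n ℓ K) :
    diagFun (Pi.mulSingle j ξ) χ = constRat n (χ.char ((j : ℕ) + 1) ξ) := by
  rw [diagFun_apply, Fintype.prod_eq_single j fun i hi => ?_, Pi.mulSingle_eq_same]
  rw [Pi.mulSingle_eq_of_ne hi, map_one, map_one]

theorem diagFun_comp_swap (hn : 2 ≤ n) {j : ℤ} (hj : 1 ≤ j) (hj' : j + 1 ≤ n)
    (d : Fin n → rootsOfUnity ℓ K) :
    diagFun (d ∘ Equiv.swap (pos n j) (pos n (j + 1))) = funAct n ℓ K (refl hn j) (diagFun d) := by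
  ext χ
  rw [funAct_apply, diagFun_apply, diagFun_apply, map_prod,
    ← Equiv.prod_comp (Equiv.swap (pos n j) (pos n (j + 1)))]
  refine Finset.prod_congr rfl fun i _ => ?_
  rw [ratAct_constRat, Weight.comp_char, pos_refl_apply hn hj hj', Function.comp_apply,
    Equiv.swap_apply_self]

theorem hFun_mul_diagFun (hn : 2 ≤ n) (k : Polynomial K) {j : ℤ} (hj : 1 ≤ j) (hj' : j + 1 ≤ n)
    (d : Fin n → rootsOfUnity ℓ K) :
    hFun k j (j + 1) * funAct n ℓ K (refl hn j) (diagFun d) = hFun k j (j + 1) * diagFun d := by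
  ext χ
  rw [Pi.mul_apply, Pi.mul_apply, hFun]
  by_cases h : χ.char j = χ.char (j + 1)
  · congr 1
    rw [funAct_apply, diagFun_apply, diagFun_apply, map_prod]
    refine Finset.prod_congr rfl fun i _ => ?_
    rw [ratAct_constRat, Weight.comp_char, refl_apply_of_mem hn (by omega) (by omega) hj hj']
    split_ifs with h1 h2
    · simp only [h1, h]
    · simp only [h2, h, add_sub_cancel_right]
    · rfl
  · rw [if_neg h, zero_mul, zero_mul]

theorem reflOp_mul_mulOp_diagFun (hn : 2 ≤ n) (k : Polynomial K) {j : ℤ} (hj : 1 ≤ j)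
    (hj' : j + 1 ≤ n) (d : Fin n → rootsOfUnity ℓ K) :
    reflOp ℓ hn k j * mulOp n ℓ K (diagFun d) =
      mulOp n ℓ K (diagFun (d ∘ Equiv.swap (pos n j) (pos n (j + 1)))) * reflOp ℓ hn k j := by
  rw [reflOp, mulOp, demazure_mul_lmul, mul_sub, hFun_mul_diagFun hn k hj hj', sub_self, map_zero,
    add_zero, diagFun_comp_swap hn hj hj']

theorem pos_natCast_add_one (i : ℕ) (hi : i < n) : pos n ((i : ℤ) + 1) = ⟨i, hi⟩ :=
  pos_val_add_one n ⟨i, hi⟩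

/-- The action of the permutations by Demazure–Lusztig operators, and its compatibility with the
diagonal matrices. -/
theorem exists_permRep (k : Polynomial K) :
    ∃ φ : Equiv.Perm (Fin n) →* Module.End (Polynomial K) (WeightFun n ℓ K),
      (∀ (hn : 2 ≤ n) (j : ℤ), 1 ≤ j → j + 1 ≤ n →
        φ (Equiv.swap (pos n j) (pos n (j + 1))) = reflOp ℓ hn k j) ∧
      ∀ w d, φ w * mulOp n ℓ K (diagFun d) = mulOp n ℓ K (diagFun (mulAutArrow w d)) * φ w := by
  by_cases hn : 2 ≤ n
  · obtain ⟨φ, hφ⟩ := (coxeterRelations_reflOp (ℓ := ℓ) hn k).exists_permHom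
    have hφ' : ∀ j : ℤ, 1 ≤ j → j + 1 ≤ n →
        φ (Equiv.swap (pos n j) (pos n (j + 1))) = reflOp ℓ hn k j := by
      intro j hj hj'
      obtain ⟨i, rfl⟩ : ∃ i : ℕ, j = (i : ℤ) + 1 := ⟨(j - 1).toNat, by omega⟩
      rw [← hφ i (by omega), pos_natCast_add_one i (by omega),
        ← pos_natCast_add_one (i + 1) (by omega)]
      push_cast
      rfl
    refine ⟨φ, fun _ => hφ', fun w => ?_⟩
    refine perm_induction_adjacent (P := fun w => ∀ d, φ w * mulOp n ℓ K (diagFun d) =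
      mulOp n ℓ K (diagFun (mulAutArrow w d)) * φ w) ?_ ?_ ?_ w
    · intro i hi d
      rw [hφ i hi, reflOp_mul_mulOp_diagFun hn k (by omega) (by omega),
        pos_natCast_add_one i (by omega), show (i : ℤ) + 1 + 1 = (i + 1 : ℕ) + 1 by push_cast; rfl,
        pos_natCast_add_one (i + 1) (by omega)]
      rfl
    · intro d
      rw [map_one, map_one, one_mul, mul_one]
      rfl
    · intro x y hx hy d
      rw [map_mul, map_mul, mul_assoc, hy, ← mul_assoc, hx, mul_assoc]
      rfl
  -- For `n = 1` the symmetric group is trivial.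
  · refine ⟨1, fun h => absurd h hn, fun w d => ?_⟩
    have : Subsingleton (Fin n) := Fin.subsingleton_iff_le_one.2 (by omega)
    rw [Subsingleton.elim w 1, map_one, map_one, one_mul, mul_one]
    rfl

end Operators

/-! ### The representation of the algebra -/

section Representation

variable {n ℓ : ℕ} [NeZero n] {K : Type*} [Field K]

/-- The action of `Γ`, by multiplications and Demazure–Lusztig operators. -/
theorem exists_groupRep (k : Polynomial K) :
    ∃ Φ : MonomialGroup n ℓ K →* Module.End (Polynomial K) (WeightFun n ℓ K),
      (∀ d, Φ (SemidirectProduct.inl d) = mulOp n ℓ K (diagFun d)) ∧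
      ∀ (hn : 2 ≤ n) (j : ℤ), 1 ≤ j → j + 1 ≤ n → Φ (sGrp n ℓ K j) = reflOp ℓ hn k j := by
  obtain ⟨φ, hφ, hd⟩ := exists_permRep (n := n) (ℓ := ℓ) k
  -- The universal property of the semidirect product is stated for groups, so the two actions are
  -- regarded as homomorphisms to the units.
  let δ : (Fin n → rootsOfUnity ℓ K) →* Module.End (Polynomial K) (WeightFun n ℓ K) :=
    (mulOp n ℓ K : _ →* _).comp diagFun
  refine ⟨(Units.coeHom _).comp (SemidirectProduct.lift δ.toHomUnits φ.toHomUnits ?_), ?_, ?_⟩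
  · intro w
    refine MonoidHom.ext fun d => ?_
    change δ.toHomUnits (mulAutArrow w d) = φ.toHomUnits w * δ.toHomUnits d * (φ.toHomUnits w)⁻¹
    rw [eq_mul_inv_iff_mul_eq]
    exact Units.ext (hd w d).symm
  · intro d
    rw [MonoidHom.comp_apply, SemidirectProduct.lift_inl]
    rfl
  · intro hn j hj hj'
    rw [MonoidHom.comp_apply, sGrp, SemidirectProduct.lift_inr, ← hφ hn j hj hj']
    rfl

/-- The function `∑_q t_a^q t_b^{-q}`, defined by its values: `ℓ` at the weights with `χ_a = χ_b` and
zero at the others. That these are the values of the sum is shown in `sum_diagFun`. -/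
noncomputable def sumFun (ℓ : ℕ) (K : Type*) [Field K] (a b : ℤ) : WeightFun n ℓ K := by
  classical exact fun χ => if χ.char a = χ.char b then (ℓ : RatFun n K) else 0

theorem hFun_mul_uFun_sub (k : Polynomial K) {a b : ℤ} (h : pos n a ≠ pos n b) :
    (hFun k a b * (uFun ℓ K a - uFun ℓ K b) : WeightFun n ℓ K) = -(k • sumFun ℓ K a b) := by
  ext χ
  have := sub_ne_zero.2 (uRat_ne n K h)
  simp only [Pi.mul_apply, Pi.sub_apply, Pi.neg_apply, Pi.smul_apply, uFun, hFun, sumFun]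
  split_ifs
  · rw [div_mul_cancel₀ _ this, Algebra.smul_def, mul_comm]
  · rw [zero_mul, smul_zero, neg_zero]

theorem hFun_mul_tFun (k : Polynomial K) (ζ : rootsOfUnity ℓ K) (a b : ℤ) :
    hFun k a b * tFun ζ a = (hFun k a b * tFun ζ b : WeightFun n ℓ K) := by
  ext χ
  rw [Pi.mul_apply, Pi.mul_apply, hFun, tFun, tFun]
  split_ifs with h
  · rw [h]
  · rw [zero_mul, zero_mul]

theorem funAct_sumFun (g : AffPerm n) (a b : ℤ) :
    funAct n ℓ K g (sumFun ℓ K a b) = sumFun ℓ K (g a) (g b) := by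
  ext χ
  rw [funAct_apply, sumFun, sumFun, apply_ite (ratAct n K g), map_natCast, map_zero]
  rfl

omit [NeZero n] in
theorem sumFun_one_add : (sumFun ℓ K (1 + n) n : WeightFun n ℓ K) = sumFun ℓ K 0 1 := by
  ext χ
  have h : χ.char (1 + n) = χ.char n ↔ χ.char 0 = χ.char 1 := by
    have := χ.char_add_inj (a := 1) (b := 0)
    rw [zero_add] at this
    rw [this, eq_comm]
  rw [sumFun, sumFun]
  by_cases e : χ.char 0 = χ.char 1
  · rw [if_pos e, if_pos (h.2 e)]
  · rw [if_neg e, if_neg (mt h.1 e)]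

/-- It is not required that `a` can be cancelled. -/
theorem mul_aeval_eq_of_mul_eq {A R : Type*} [CommRing A] [CommRing R] [Algebra A R] {a x y : R}
    (h : a * x = a * y) (p : Polynomial A) :
    a * Polynomial.aeval x p = a * Polynomial.aeval y p := by
  induction p using Polynomial.induction_on' with
  | add p q hp hq => rw [map_add, map_add, mul_add, mul_add, hp, hq]
  | monomial m c =>
    have hm : a * x ^ m = a * y ^ m := by
      induction m with
      | zero => simp
      | succ m ih => rw [pow_succ, ← mul_assoc, ih, mul_right_comm, h, mul_right_comm, mul_assoc,
          ← pow_succ]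
    rw [Polynomial.aeval_monomial, Polynomial.aeval_monomial, mul_left_comm, hm, mul_left_comm]

section Root

variable {ζ : rootsOfUnity ℓ K}

theorem char_eq_of_apply_eq (hℓ : ℓ ≠ 0) (hζ : IsPrimitiveRoot ((ζ : Kˣ) : K) ℓ)
    {χ ψ : rootsOfUnity ℓ K →* K} (h : χ ζ = ψ ζ) : χ = ψ := by
  have : NeZero ℓ := ⟨hℓ⟩
  ext ξ
  obtain ⟨i, -, hi⟩ := (IsPrimitiveRoot.coe_units_iff.1 hζ).eq_pow_of_mem_rootsOfUnity ξ.2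
  obtain rfl : ζ ^ i = ξ := Subtype.ext hi
  rw [map_pow, map_pow, h]

/-- The orthogonality of the characters `χ` and `ψ` of `μ_ℓ`. -/
theorem sum_char_pow (hℓ : ℓ ≠ 0) (hζ : IsPrimitiveRoot ((ζ : Kˣ) : K) ℓ)
    [DecidableEq (rootsOfUnity ℓ K →* K)] (χ ψ : rootsOfUnity ℓ K →* K) :
    ∑ q ∈ Finset.range ℓ, (χ ζ * ψ ζ⁻¹) ^ q = if χ = ψ then (ℓ : K) else 0 := by
  have hψ : ψ ζ⁻¹ * ψ ζ = 1 := by rw [← map_mul, inv_mul_cancel, map_one]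
  split_ifs with h
  · rw [h, mul_comm, hψ]
    simp
  · have h1 : χ ζ * ψ ζ⁻¹ - 1 ≠ 0 := by
      intro h1
      refine h (char_eq_of_apply_eq hℓ hζ ?_)
      linear_combination ψ ζ * h1 - χ ζ * hψ
    have hz : ζ ^ ℓ = 1 := Subtype.ext ζ.2
    have h2 := mul_geom_sum (χ ζ * ψ ζ⁻¹) ℓ
    rw [mul_pow, ← map_pow, ← map_pow, inv_pow, hz, inv_one, map_one, map_one, one_mul,
      sub_self] at h2
    exact (mul_eq_zero.1 h2).resolve_left h1

omit [NeZero n] in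
theorem diagFun_tGrp_apply (a b : Fin n) (q : ℕ) (χ : Weight n ℓ K) :
    diagFun (Pi.mulSingle a ζ ^ q * (Pi.mulSingle b ζ ^ q)⁻¹) χ =
      constRat n ((χ.char ((a : ℕ) + 1) ζ * χ.char ((b : ℕ) + 1) ζ⁻¹) ^ q) := by
  rw [← inv_pow, ← Pi.mulSingle_inv, map_mul, map_pow, map_pow, Pi.mul_apply, Pi.pow_apply,
    Pi.pow_apply, diagFun_mulSingle, diagFun_mulSingle, mul_pow, map_mul, map_pow, map_pow]

omit [NeZero n] in
theorem sum_diagFun (hℓ : ℓ ≠ 0) (hζ : IsPrimitiveRoot ((ζ : Kˣ) : K) ℓ) (a b : Fin n) :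
    ∑ q ∈ Finset.range ℓ, diagFun (Pi.mulSingle a ζ ^ q * (Pi.mulSingle b ζ ^ q)⁻¹) =
      (sumFun ℓ K ((a : ℕ) + 1) ((b : ℕ) + 1) : WeightFun n ℓ K) := by
  classical
  ext χ
  rw [Finset.sum_apply, sumFun]
  simp only [diagFun_tGrp_apply]
  rw [← map_sum, sum_char_pow hℓ hζ, apply_ite (constRat n), map_natCast, map_zero]

omit [NeZero n] in
/-- The sum in the last relation is the function `∑_q t_{a+n}^q t_b^{-q}` with `a = 1` and
`b = n`, because `ζ t_a = t_{a+n}`. -/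
theorem sum_smul_diagFun (hℓ : ℓ ≠ 0) (hζ : IsPrimitiveRoot ((ζ : Kˣ) : K) ℓ) (a b : Fin n) :
    ∑ q ∈ Finset.range ℓ,
        zetaPow ζ q • diagFun (Pi.mulSingle a ζ ^ q * (Pi.mulSingle b ζ ^ q)⁻¹) =
      (sumFun ℓ K ((a : ℕ) + 1 + n) ((b : ℕ) + 1) : WeightFun n ℓ K) := by
  classical
  ext χ
  rw [Finset.sum_apply, sumFun]
  have (q : ℕ) : (zetaPow ζ q •
      diagFun (Pi.mulSingle a ζ ^ q * (Pi.mulSingle b ζ ^ q)⁻¹) : WeightFun n ℓ K) χ =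
      constRat n ((χ.char ((a : ℕ) + 1 + n) ζ * χ.char ((b : ℕ) + 1) ζ⁻¹) ^ q) := by
    rw [Pi.smul_apply, diagFun_tGrp_apply, χ.char_add, Algebra.smul_def, mul_assoc, mul_pow (ζ.1.1),
      map_mul, zetaPow, zpow_natCast, Units.val_pow_eq_pow_val]
    rfl
  simp only [this]
  rw [← map_sum, sum_char_pow hℓ hζ, apply_ite (constRat n), map_natCast, map_zero]

end Root

/-- The function `u_i + p(t_i)`. -/
noncomputable def sigFun (ζ : rootsOfUnity ℓ K) (h : Fin (ℓ + 1) → Polynomial K) (i : ℤ) :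
    WeightFun n ℓ K :=
  uFun ℓ K i + Polynomial.aeval (tFun ζ i) (pPoly ζ h)

theorem funAct_sigFun (ζ : rootsOfUnity ℓ K) (h : Fin (ℓ + 1) → Polynomial K) (g : AffPerm n)
    (i : ℤ) : funAct n ℓ K g (sigFun ζ h i) = sigFun ζ h (g i) := by
  rw [sigFun, map_add, funAct_uFun, ← Polynomial.aeval_algHom_apply, funAct_tFun, sigFun]

theorem hFun_mul_sigFun_sub (k : Polynomial K) (ζ : rootsOfUnity ℓ K)
    (h : Fin (ℓ + 1) → Polynomial K) {a b : ℤ} (hab : pos n a ≠ pos n b) :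
    (hFun k a b * (sigFun ζ h a - sigFun ζ h b) : WeightFun n ℓ K) = -(k • sumFun ℓ K a b) := by
  rw [← hFun_mul_uFun_sub k hab, sigFun, sigFun]
  linear_combination mul_aeval_eq_of_mul_eq (hFun_mul_tFun (n := n) k ζ a b) (pPoly ζ h)

theorem uFun_eq (i : ℤ) : (uFun ℓ K i : WeightFun n ℓ K) =
    (uFun ℓ K ((pos n i : ℕ) + 1) : WeightFun n ℓ K) -
      algebraMap (Polynomial K) (WeightFun n ℓ K) ((turns n i : Polynomial K) * hbar K) := by
  ext χ
  have := uPoly_add_mul n K ((pos n i : ℕ) + 1) (turns n i)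
  rw [pos_add_mul_turns] at this
  rw [uFun, uRat, this, map_sub]
  rfl

theorem tFun_eq (ζ : rootsOfUnity ℓ K) (i : ℤ) : (tFun ζ i : WeightFun n ℓ K) =
    zetaPow ζ (turns n i) • diagFun (Pi.mulSingle (pos n i) ζ) := by
  ext χ
  rw [Pi.smul_apply, diagFun_mulSingle, tFun]
  conv_lhs => rw [← pos_add_mul_turns n i, χ.char_add_mul, map_mul]
  rw [Algebra.smul_def]
  rfl

section Rep

variable (ζ : rootsOfUnity ℓ K) (h : Fin (ℓ + 1) → Polynomial K)
  (Φ : MonomialGroup n ℓ K →* Module.End (Polynomial K) (WeightFun n ℓ K))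

/-- The action of the free algebra on functions in which the group acts by `Φ`, each `u_i` by
multiplication, `τ` by the inverse shift, and `σ` by the shift followed by the multiplication by
`u_1 + p(t_1)`. -/
noncomputable def freeRep :
    Free n ℓ K →ₐ[Polynomial K] Module.End (Polynomial K) (WeightFun n ℓ K) :=
  FreeAlgebra.lift (Polynomial K) fun
    | .grp g => Φ g
    | .sigma => mulOp n ℓ K (sigFun ζ h 1) * shiftOp n ℓ K
    | .tau => shiftInvOp n ℓ K
    | .u i => mulOp n ℓ K (uFun ℓ K ((i : ℕ) + 1))

theorem freeRep_γ (g : MonomialGroup n ℓ K) : freeRep ζ h Φ (γ g) = Φ g := by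
  simp [freeRep, γ]

theorem freeRep_sig : freeRep ζ h Φ sig = mulOp n ℓ K (sigFun ζ h 1) * shiftOp n ℓ K := by
  simp [freeRep, sig]

theorem freeRep_tau : freeRep ζ h Φ tau = shiftInvOp n ℓ K := by
  simp [freeRep, tau]

theorem freeRep_uGen (i : Fin n) :
    freeRep ζ h Φ (uGen i) = mulOp n ℓ K (uFun ℓ K ((i : ℕ) + 1)) := by
  simp [freeRep, uGen]

theorem freeRep_uInt (i : ℤ) : freeRep ζ h Φ (uInt i) = mulOp n ℓ K (uFun ℓ K i) := by
  rw [uInt, map_sub, freeRep_uGen, AlgHom.commutes, uFun_eq i, map_sub, AlgHom.commutes]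

variable {Φ}

theorem freeRep_tInt (hd : ∀ d, Φ (SemidirectProduct.inl d) = mulOp n ℓ K (diagFun d)) (i : ℤ) :
    freeRep ζ h Φ (tInt ζ i) = mulOp n ℓ K (tFun ζ i) := by
  rw [tInt, map_smul, freeRep_γ, tGrp, hd, tFun_eq, map_smul]

omit [NeZero n] in
theorem rep_tGrp (hd : ∀ d, Φ (SemidirectProduct.inl d) = mulOp n ℓ K (diagFun d))
    (a b : Fin n) (q : ℕ) : Φ (tGrp ζ a ^ q * (tGrp ζ b ^ q)⁻¹) =
      mulOp n ℓ K (diagFun (Pi.mulSingle a ζ ^ q * (Pi.mulSingle b ζ ^ q)⁻¹)) := by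
  rw [tGrp, tGrp, ← map_pow, ← map_pow, ← map_inv, ← map_mul, hd]

theorem pos_val_add_one_of_mem {i : ℤ} (h1 : 1 ≤ i) (h2 : i ≤ n) :
    ((pos n i : ℕ) : ℤ) + 1 = i := by
  rw [pos_val_of_mem n h1 h2, sub_add_cancel]

theorem hFun_mul_uFun_refl (hn : 2 ≤ n) (k : Polynomial K) (i : Fin n) {j : ℤ} (hj : 1 ≤ j)
    (hj' : j + 1 ≤ n) :
    hFun k j (j + 1) * (uFun ℓ K (refl hn j ((i : ℕ) + 1)) - uFun ℓ K ((i : ℕ) + 1)) =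
      ((k * (coroot j i : Polynomial K)) • sumFun ℓ K j (j + 1) : WeightFun n ℓ K) := by
  have hp : pos n j ≠ pos n (j + 1) := pos_ne hj (by omega) (by omega) hj' (by omega)
  have key := hFun_mul_uFun_sub (ℓ := ℓ) k hp
  have h1 := pos_val_add_one_of_mem (n := n) hj (by omega)
  have h2 := pos_val_add_one_of_mem (n := n) (i := j + 1) (by omega) hj'
  rw [coroot]
  by_cases e1 : i = pos n j
  · rw [if_pos e1, if_neg (fun e => hp (e1.symm.trans e)), e1, h1, refl_apply_left, sub_zero,
      Int.cast_one, mul_one]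
    linear_combination -key
  · by_cases e2 : i = pos n (j + 1)
    · rw [if_neg e1, if_pos e2, e2, h2, refl_apply_right, key, zero_sub, Int.cast_neg,
        Int.cast_one, mul_neg, mul_one, neg_smul]
    · have e3 : ((i : ℕ) : ℤ) + 1 ≠ j := fun e => e1 (Fin.ext (by omega))
      have e4 : ((i : ℕ) : ℤ) + 1 ≠ j + 1 := fun e => e2 (Fin.ext (by omega))
      rw [if_neg e1, if_neg e2, refl_apply_of_ne hn (by omega) (by omega) hj hj' e3 e4, sub_self,
        mul_zero, sub_self, Int.cast_zero, mul_zero, zero_smul]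

theorem freeRep_sw (k : Polynomial K)
    (hs : ∀ (hn : 2 ≤ n) (j : ℤ), 1 ≤ j → j + 1 ≤ n → Φ (sGrp n ℓ K j) = reflOp ℓ hn k j)
    (hn : 2 ≤ n) {j : ℤ} (hj : 1 ≤ j) (hj' : j + 1 ≤ n) :
    freeRep ζ h Φ (sw j) = reflOp ℓ hn k j := by
  rw [sw, freeRep_γ, hs hn j hj hj']

theorem freeRep_hecke (hℓ : ℓ ≠ 0) (hζ : IsPrimitiveRoot ((ζ : Kˣ) : K) ℓ) (k : Polynomial K)
    (hd : ∀ d, Φ (SemidirectProduct.inl d) = mulOp n ℓ K (diagFun d))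
    (hs : ∀ (hn : 2 ≤ n) (j : ℤ), 1 ≤ j → j + 1 ≤ n → Φ (sGrp n ℓ K j) = reflOp ℓ hn k j)
    (i : Fin n) {j : ℤ} (hj : 1 ≤ j) (hj' : j + 1 ≤ n) :
    freeRep ζ h Φ (uGen i * sw j) =
      freeRep ζ h Φ (sw j * uGen (Equiv.swap (pos n j) (pos n (j + 1)) i) -
        (k * (coroot j i : Polynomial K)) • ∑ q ∈ Finset.range ℓ,
          γ (tGrp ζ (pos n j) ^ q * (tGrp ζ (pos n (j + 1)) ^ q)⁻¹)) := by
  have hn : 2 ≤ n := by omega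
  have hE : freeRep ζ h Φ (∑ q ∈ Finset.range ℓ,
      γ (tGrp ζ (pos n j) ^ q * (tGrp ζ (pos n (j + 1)) ^ q)⁻¹)) =
      mulOp n ℓ K (sumFun ℓ K j (j + 1)) := by
    simp only [map_sum, freeRep_γ, rep_tGrp ζ hd]
    rw [← map_sum, sum_diagFun hℓ hζ, pos_val_add_one_of_mem hj (by omega),
      pos_val_add_one_of_mem (by omega) hj']
  have hu : refl hn j (refl hn j ((i : ℕ) + 1)) = (i : ℕ) + 1 :=
    DFunLike.congr_fun (refl_mul_self hn j) _
  rw [map_mul, map_sub, map_mul, map_smul, freeRep_sw ζ h k hs hn hj hj', hE, freeRep_uGen,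
    freeRep_uGen,
    ← pos_refl_apply hn hj hj', reflOp, mulOp, demazure_mul_lmul, funAct_uFun, hu,
    hFun_mul_uFun_refl hn k i hj hj', map_smul, add_sub_cancel_right]

theorem freeRep_tau_sig (hd : ∀ d, Φ (SemidirectProduct.inl d) = mulOp n ℓ K (diagFun d)) :
    freeRep ζ h Φ (tau * sig) = freeRep ζ h Φ (uInt n +
      algebraMap (Polynomial K) (Free n ℓ K) (hbar K) +
        Polynomial.aeval (zetaPow ζ (-1) • tInt ζ n) (pPoly ζ h)) := by
  have hu : (uFun ℓ K 0 : WeightFun n ℓ K) =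
      uFun ℓ K n + algebraMap (Polynomial K) (WeightFun n ℓ K) (hbar K) := by
    ext χ
    have := uRat_add n K 0
    rw [zero_add] at this
    rw [Pi.add_apply, uFun, uFun, this]
    exact (sub_add_cancel _ _).symm
  have ht : zetaPow ζ (-1) • tFun ζ n = (tFun ζ 0 : WeightFun n ℓ K) := by
    ext χ
    have := χ.char_add_mul n (-1) ζ
    rw [neg_one_mul, add_neg_cancel] at this
    rw [Pi.smul_apply, tFun, tFun, this, map_mul, Algebra.smul_def]
    rfl
  have ht' : freeRep ζ h Φ (zetaPow ζ (-1) • tInt ζ n) = mulOp n ℓ K (tFun ζ 0) := by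
    rw [← ht, map_smul, map_smul, freeRep_tInt ζ h hd]
  have hp : freeRep ζ h Φ (Polynomial.aeval (zetaPow ζ (-1) • tInt ζ n) (pPoly ζ h)) =
      mulOp n ℓ K (Polynomial.aeval (tFun ζ 0) (pPoly ζ h)) := by
    rw [← Polynomial.aeval_algHom_apply, ht', Polynomial.aeval_algHom_apply]
  rw [map_mul, map_add, map_add, freeRep_sig, freeRep_tau, ← mul_assoc, shiftInvOp_mul_mulOp,
    mul_assoc, shiftInvOp_mul_shiftOp, mul_one, freeRep_uInt ζ h Φ n, AlgHom.commutes, hp,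
    funAct_sigFun, shift_inv_apply, sub_self, sigFun, hu, map_add, map_add, AlgHom.commutes]

/-- The last relation. Conjugation by the inverse shift takes the operators of index `1` to those of
index `0`, and the operator of index `0` is that of index `n`, which arises from the index `n - 1` by
conjugation with the shift. The term with `k` comes from moving `u_1 + p(t_1)` past the operator of
index `1`. -/
theorem freeRep_last (hℓ : ℓ ≠ 0) (hζ : IsPrimitiveRoot ((ζ : Kˣ) : K) ℓ) (k : Polynomial K)
    (hd : ∀ d, Φ (SemidirectProduct.inl d) = mulOp n ℓ K (diagFun d))
    (hs : ∀ (hn : 2 ≤ n) (j : ℤ), 1 ≤ j → j + 1 ≤ n → Φ (sGrp n ℓ K j) = reflOp ℓ hn k j)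
    (hn : 2 ≤ n) :
    freeRep ζ h Φ (tau * sw 1 * sig) =
      freeRep ζ h Φ (sig * sw ((n : ℤ) - 1) * tau - k • ∑ q ∈ Finset.range ℓ,
        zetaPow ζ q • γ (tGrp ζ (pos n 1) ^ q * (tGrp ζ (pos n n) ^ q)⁻¹)) := by
  have hE : freeRep ζ h Φ (∑ q ∈ Finset.range ℓ,
      zetaPow ζ q • γ (tGrp ζ (pos n 1) ^ q * (tGrp ζ (pos n n) ^ q)⁻¹)) =
      mulOp n ℓ K (sumFun ℓ K 0 1) := by
    simp only [map_sum, map_smul, freeRep_γ, rep_tGrp ζ hd]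
    simp only [← map_smul]
    rw [← map_sum, sum_smul_diagFun hℓ hζ, pos_val_add_one_of_mem le_rfl (by omega),
      pos_val_add_one_of_mem (by omega) le_rfl, sumFun_one_add]
  have h12 : pos n 1 ≠ pos n (1 + 1) := by apply pos_ne <;> omega
  have hl := refl_apply_left hn 1
  rw [map_mul, map_mul, map_sub, map_mul, map_mul, map_smul, hE, freeRep_sig, freeRep_tau,
    freeRep_sw ζ h k hs hn le_rfl (by omega), freeRep_sw ζ h k hs hn (by omega) (by omega)]
  have hleft : reflOp ℓ hn k 1 * mulOp n ℓ K (sigFun ζ h 1) =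
      mulOp n ℓ K (sigFun ζ h 2) * reflOp ℓ hn k 1 - mulOp n ℓ K (k • sumFun ℓ K 1 2) := by
    rw [reflOp, mulOp, demazure_mul_lmul, funAct_sigFun, hl, hFun_mul_sigFun_sub k ζ h h12,
      map_neg, ← sub_eq_add_neg]
    rfl
  have h0 : shiftInvOp n ℓ K * reflOp ℓ hn k 1 =
      reflOp ℓ hn k (n : ℤ) * shiftInvOp n ℓ K := by
    have := reflOp_mul_shiftInvOp (ℓ := ℓ) hn k 0
    rw [zero_add] at this
    rw [← this, ← reflOp_add, zero_add]
  have hn1 : shiftOp n ℓ K * reflOp ℓ hn k ((n : ℤ) - 1) =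
      reflOp ℓ hn k (n : ℤ) * shiftOp n ℓ K := by
    rw [shiftOp_mul_reflOp, sub_add_cancel]
  calc shiftInvOp n ℓ K * reflOp ℓ hn k 1 * (mulOp n ℓ K (sigFun ζ h 1) * shiftOp n ℓ K)
      = shiftInvOp n ℓ K * (reflOp ℓ hn k 1 * mulOp n ℓ K (sigFun ζ h 1)) *
          shiftOp n ℓ K := by simp only [mul_assoc]
    _ = (shiftInvOp n ℓ K * mulOp n ℓ K (sigFun ζ h 2)) * reflOp ℓ hn k 1 * shiftOp n ℓ K -
          (shiftInvOp n ℓ K * mulOp n ℓ K (k • sumFun ℓ K 1 2)) * shiftOp n ℓ K := by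
        rw [hleft]; simp only [mul_assoc, mul_sub, sub_mul]
    _ = mulOp n ℓ K (sigFun ζ h 1) * (shiftInvOp n ℓ K * reflOp ℓ hn k 1) * shiftOp n ℓ K -
          mulOp n ℓ K (k • sumFun ℓ K 0 1) * (shiftInvOp n ℓ K * shiftOp n ℓ K) := by
        rw [shiftInvOp_mul_mulOp, shiftInvOp_mul_mulOp, funAct_sigFun, map_smul, funAct_sumFun]
        simp only [mul_assoc]
        rfl
    _ = mulOp n ℓ K (sigFun ζ h 1) * reflOp ℓ hn k (n : ℤ) -
          k • mulOp n ℓ K (sumFun ℓ K 0 1) := by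
        rw [h0, shiftInvOp_mul_shiftOp, mul_one, mul_assoc, mul_assoc, shiftInvOp_mul_shiftOp,
          mul_one, map_smul]
    _ = mulOp n ℓ K (sigFun ζ h 1) * shiftOp n ℓ K * reflOp ℓ hn k ((n : ℤ) - 1) *
          shiftInvOp n ℓ K - k • mulOp n ℓ K (sumFun ℓ K 0 1) := by
        rw [mul_assoc (mulOp n ℓ K _), hn1, mul_assoc, mul_assoc, shiftOp_mul_shiftInvOp,
          mul_one]

/-- The operators satisfy the defining relations of the algebra. -/
theorem freeRep_eq_of_rel (hℓ : ℓ ≠ 0) (hζ : IsPrimitiveRoot ((ζ : Kˣ) : K) ℓ)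
    (k : Polynomial K) (hd : ∀ d, Φ (SemidirectProduct.inl d) = mulOp n ℓ K (diagFun d))
    (hs : ∀ (hn : 2 ≤ n) (j : ℤ), 1 ≤ j → j + 1 ≤ n → Φ (sGrp n ℓ K j) = reflOp ℓ hn k j)
    {x y : Free n ℓ K} (hxy : Rel ζ k h x y) : freeRep ζ h Φ x = freeRep ζ h Φ y := by
  have hsw (hn : 2 ≤ n) {j : ℤ} (hj : 1 ≤ j) (hj' : j + 1 ≤ n) :=
    freeRep_sw ζ h k hs hn hj hj'
  have hcomm (f g : WeightFun n ℓ K) : mulOp n ℓ K f * mulOp n ℓ K g =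
      mulOp n ℓ K g * mulOp n ℓ K f := by
    rw [← map_mul, mul_comm, map_mul]
  cases hxy with
  | grp_one => rw [freeRep_γ, map_one, map_one]
  | grp_mul a b => rw [map_mul, freeRep_γ, freeRep_γ, freeRep_γ, map_mul]
  | hecke i j hj hj' =>
    exact freeRep_hecke ζ h hℓ hζ k hd hs i hj (by omega)
  | sig_swap j hj hj' =>
    have hn : 2 ≤ n := by omega
    have hj' : j + 1 ≤ n := by omega
    have hu : refl hn j 1 = 1 :=
      refl_apply_of_ne hn (by omega) (by omega) (by omega) hj' (by omega) (by omega)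
    rw [map_mul, map_mul, freeRep_sig, hsw hn (j := j - 1) (by omega) (by omega),
      hsw hn (j := j) (by omega) hj', mul_assoc, shiftOp_mul_reflOp, sub_add_cancel, ← mul_assoc,
      ← mul_assoc, reflOp, mulOp, demazure_mul_lmul, funAct_sigFun, hu, sub_self, mul_zero,
      map_zero, add_zero]
  | tau_swap j hj hj' =>
    have hn : 2 ≤ n := by omega
    rw [map_mul, map_mul, freeRep_tau, hsw hn (j := j - 1) (by omega) (by omega),
      hsw hn (j := j) (by omega) (by omega), reflOp_mul_shiftInvOp, sub_add_cancel]
  | sig_tau =>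
    rw [map_mul, map_add, freeRep_sig, freeRep_tau, mul_assoc, shiftOp_mul_shiftInvOp, mul_one,
      freeRep_uInt, ← Polynomial.aeval_algHom_apply, freeRep_tInt ζ h hd,
      Polynomial.aeval_algHom_apply, ← map_add, sigFun]
  | tau_sig =>
    exact freeRep_tau_sig ζ h hd
  | u_comm i j => rw [map_mul, map_mul, freeRep_uInt, freeRep_uInt, hcomm]
  | u_sig i =>
    rw [map_mul, map_mul, freeRep_sig, freeRep_uInt, freeRep_uInt, mul_assoc, shiftOp_mul_mulOp,
      funAct_uFun, shift_apply, sub_add_cancel, ← mul_assoc, ← mul_assoc, hcomm]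
  | u_tau i =>
    rw [map_mul, map_mul, freeRep_tau, freeRep_uInt, freeRep_uInt, shiftInvOp_mul_mulOp,
      funAct_uFun, shift_inv_apply, add_sub_cancel_right]
  | t_sig i =>
    rw [map_mul, map_mul, freeRep_sig, freeRep_tInt ζ h hd, freeRep_tInt ζ h hd, mul_assoc,
      shiftOp_mul_mulOp, funAct_tFun, shift_apply, sub_add_cancel, ← mul_assoc, ← mul_assoc, hcomm]
  | t_tau i =>
    rw [map_mul, map_mul, freeRep_tau, freeRep_tInt ζ h hd, freeRep_tInt ζ h hd,
      shiftInvOp_mul_mulOp, funAct_tFun, shift_inv_apply, add_sub_cancel_right]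
  | last hn =>
    exact freeRep_last ζ h hℓ hζ k hd hs hn

end Rep

end Representation

open scoped IsMulCommutative in
/-- Commuting elements of an algebra generate a polynomial algebra if they become algebraically
independent under a homomorphism. -/
theorem exists_algEquiv_adjoin {ι A B C : Type*} [CommSemiring A] [Semiring B]
    [Algebra A B] [Semiring C] [Algebra A C] (x : ι → B) (hx : ∀ i j, Commute (x i) (x j))
    (ρ : B →ₐ[A] C)
    (ψ : MvPolynomial ι A →ₐ[A] C) (hψ : Function.Injective ψ)
    (h : ∀ i, ρ (x i) = ψ (MvPolynomial.X i)) :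
    ∃ e : MvPolynomial ι A ≃ₐ[A] Algebra.adjoin A (Set.range x),
      ∀ i, (e (MvPolynomial.X i) : B) = x i := by
  have hcomm := Algebra.isMulCommutative_adjoin A (s := Set.range x) (by
    rintro _ ⟨i, rfl⟩ _ ⟨j, rfl⟩
    exact hx i j)
  let y : ι → Algebra.adjoin A (Set.range x) := fun i => ⟨x i, Algebra.subset_adjoin ⟨i, rfl⟩⟩
  let φ : MvPolynomial ι A →ₐ[A] Algebra.adjoin A (Set.range x) := MvPolynomial.aeval y
  have hφ (i : ι) : φ (MvPolynomial.X i) = y i := MvPolynomial.aeval_X y i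
  have hcomp : (ρ.comp (Subalgebra.val _)).comp φ = ψ := by
    refine MvPolynomial.algHom_ext fun i => ?_
    rw [AlgHom.comp_apply, hφ]
    exact h i
  have hinj : Function.Injective φ := by
    intro p q hpq
    apply hψ
    rw [← hcomp, AlgHom.comp_apply, hpq]
    rfl
  have hle : Algebra.adjoin A (Set.range x) ≤ ((Subalgebra.val _).comp φ).range := by
    refine Algebra.adjoin_le ?_
    rintro _ ⟨i, rfl⟩
    exact ⟨MvPolynomial.X i, congrArg Subtype.val (hφ i)⟩
  have hsurj : Function.Surjective φ := by
    intro z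
    obtain ⟨p, hp⟩ := hle z.2
    exact ⟨p, Subtype.ext hp⟩
  exact ⟨AlgEquiv.ofBijective φ ⟨hinj, hsurj⟩, fun i => congrArg Subtype.val (hφ i)⟩

/-! ### Algebraic independence -/

section Main

variable {n ℓ : ℕ} [NeZero n] {K : Type*} [Field K]

theorem u_commute (ζ : rootsOfUnity ℓ K) (k : Polynomial K) (h : Fin (ℓ + 1) → Polynomial K)
    (i j : Fin n) : Commute (u (n := n) ζ k h i) (u (n := n) ζ k h j) := by
  have hu (i : Fin n) : (uInt ((i : ℕ) + 1) : Free n ℓ K) = uGen i := by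
    rw [uInt, pos_val_add_one, turns_of_mem n (by omega) (by omega), Int.cast_zero, zero_mul,
      map_zero, sub_zero]
  have := RingQuot.mkAlgHom_rel (Polynomial K)
    (Rel.u_comm (ζ := ζ) (k := k) (h := h) (n := n) ((i : ℕ) + 1) ((j : ℕ) + 1))
  rwa [hu, hu, map_mul, map_mul] at this

/-- The algebra acts on the functions on the set of weights in such a way that each `u_i` acts by
multiplication. -/
theorem exists_rep {ζ : rootsOfUnity ℓ K} (hℓ : ℓ ≠ 0) (hζ : IsPrimitiveRoot ((ζ : Kˣ) : K) ℓ)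
    (k : Polynomial K) (h : Fin (ℓ + 1) → Polynomial K) :
    ∃ ρ : Alg (n := n) ζ k h →ₐ[Polynomial K] Module.End (Polynomial K) (WeightFun n ℓ K),
      ∀ i, ρ (u ζ k h i) = mulOp n ℓ K (uFun ℓ K ((i : ℕ) + 1)) := by
  obtain ⟨Φ, hd, hs⟩ := exists_groupRep (n := n) (ℓ := ℓ) k
  refine ⟨RingQuot.liftAlgHom (Polynomial K) ⟨freeRep ζ h Φ, fun _ _ hxy =>
    freeRep_eq_of_rel ζ h hℓ hζ k hd hs hxy⟩, fun i => ?_⟩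
  rw [u, RingQuot.liftAlgHom_mkAlgHom_apply, freeRep_uGen]

variable (n ℓ K) in
/-- Polynomials in `u_1, …, u_n` as multiplication operators. -/
noncomputable def polyOp : MvPolynomial (Fin n) (Polynomial K) →ₐ[Polynomial K]
    Module.End (Polynomial K) (WeightFun n ℓ K) :=
  (mulOp n ℓ K).comp ((Pi.constAlgHom (Polynomial K) (Weight n ℓ K) (RatFun n K)).comp
    (IsScalarTower.toAlgHom (Polynomial K) (MvPolynomial (Fin n) (Polynomial K)) (RatFun n K)))

theorem polyOp_injective : Function.Injective (polyOp n ℓ K) := by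
  intro p q hpq
  obtain ⟨χ⟩ : Nonempty (Weight n ℓ K) := inferInstance
  -- A multiplication operator is recovered from its value at the constant function `1`.
  have h1 (p : MvPolynomial (Fin n) (Polynomial K)) :
      polyOp n ℓ K p 1 χ = algebraMap _ (RatFun n K) p :=
    mul_one (algebraMap (MvPolynomial (Fin n) (Polynomial K)) (RatFun n K) p)
  refine IsFractionRing.injective (MvPolynomial (Fin n) (Polynomial K)) (RatFun n K) ?_
  rw [← h1, ← h1, hpq]

theorem polyOp_X (i : Fin n) :
    polyOp n ℓ K (MvPolynomial.X i) = mulOp n ℓ K (uFun ℓ K ((i : ℕ) + 1)) := by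
  rw [← uPoly_of_fin]
  rfl

end Main

end DunklOpdam

theorem lemma2p5 {K : Type*} [Field K] (n ℓ : ℕ) [NeZero n] (hℓ : (ℓ : K) ≠ 0)
    (ζ : rootsOfUnity ℓ K) (hζ : IsPrimitiveRoot ((ζ : Kˣ) : K) ℓ)
    (k : Polynomial K) (h : Fin (ℓ + 1) → Polynomial K) :
    (∀ i j : Fin n, Commute (DunklOpdam.u (n := n) ζ k h i) (DunklOpdam.u (n := n) ζ k h j)) ∧
    ∃ e : MvPolynomial (Fin n) (Polynomial K) ≃ₐ[Polynomial K]
        Algebra.adjoin (Polynomial K) (Set.range (DunklOpdam.u (n := n) ζ k h)),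
      ∀ i : Fin n, (e (MvPolynomial.X i) : DunklOpdam.Alg (n := n) ζ k h) =
        DunklOpdam.u (n := n) ζ k h i := by
  have hℓ0 : ℓ ≠ 0 := by
    rintro rfl
    exact hℓ Nat.cast_zero
  obtain ⟨ρ, hρ⟩ := DunklOpdam.exists_rep (n := n) hℓ0 hζ k h
  exact ⟨DunklOpdam.u_commute ζ k h, DunklOpdam.exists_algEquiv_adjoin _
    (DunklOpdam.u_commute ζ k h) ρ (DunklOpdam.polyOp n ℓ K) DunklOpdam.polyOp_injective
    fun i => (hρ i).trans (DunklOpdam.polyOp_X i).symm⟩
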